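/- Let $\Phi$ be an irreducible (reduced, crystallographic) root system spanning a Euclidean space $E$ with inner product $(\cdot,\cdot)$, let $W$ be its Weyl group, generated by the reflections $s_\alpha$ $(\alpha\in\Phi)$, and put $\alpha^\vee = 2\alpha/(\alpha,\alpha)$. Let $Z=\{x\in E : (\alpha,x)\in\mathbb{Z}\text{ for all }\alpha\in\Phi\}$ be the coweight lattice, $Q^\vee=\sum_{\alpha\in\Phi}\mathbb{Z}\alpha^\vee\subseteq Z$ the coroot lattice, and $f=(Z:Q^\vee)$ the index of connection. Fix simple roots $\alpha_1,\dots,\alpha_\ell$, let $\tilde\alpha$ be the highest root (the root of greatest height), and let $$A_\circ=\{x\in E : (\alpha_i,x)>0 \text{ for } 1\le i\le \ell,\ (\tilde\alpha,x)<1\}$$ be the fundamental alcove. Let $T=E/Z$, with projection $\pi_T:E\to T$ and the induced action of $W$, and let $W_{A_\circ}=\{w\in W : w(\pi_T(A_\circ))=\pi_T(A_\circ)\}$. For an integer $q\ge 1$, let $\chi_{\mathcal{A},q}$ be the character of the complex permutation representation of $W$ on $$M(\mathcal{A};q)=\{\bar x\in Z/qZ : (\alpha,x)\not\equiv 0 \pmod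 q\text{ for all }\alpha\in\Phi\},$$ let $\chi_{A_\circ,q}$ be the character of the complex permutation representation of $W_{A_\circ}$ on the set $\{t\in\pi_T(A_\circ) : qt=0\}$ of $q$-torsion points, and let $L_{A_\circ}(q)=\#(qA_\circ\cap Z)$. For a subgroup $H$ of a finite group $G$ and a character $\psi$ of $H$, let $(\mathrm{Ind}_H^G\psi)(g)=\frac{1}{\#H}\sum_{s\in G,\ s^{-1}gs\in H}\psi(s^{-1}gs)$. Then: 1. for every integer $q\ge 1$, $\ \chi_{\mathcal{A},q}=\mathrm{Ind}_{W_{A_\circ}}^{W}\chi_{A_\circ,q}$; 2. $\#W_{A_\circ}=f$; 3. for every integer $q\ge 1$, $\ f\cdot\#M(\mathcal{A};q)=\#W\cdot L_{A_\circ}(q)$. -/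

import Mathlib

open scoped Pointwise

namespace EquivCharQuasi

noncomputable section

/-! ### Characters -/

/-- The character of the (complex) permutation representation of `G` on `X`. -/
def permChar (G X : Type*) [Group G] [MulAction G X] : G → ℂ :=
  (Representation.ofMulAction ℂ G X).character

/-- The induced class function
`(Ind_H^G ψ)(g) = (1 / #H) ∑_{s ∈ G, s⁻¹ g s ∈ H} ψ (s⁻¹ g s)` of a finite group `G`. -/
def inducedChar {G : Type*} [Group G] [Finite G] (H : Subgroup G) (ψ : H → ℂ) (g : G) : ℂ :=
  (Nat.card H : ℂ)⁻¹ * ∑ᶠ s : {s : G // s⁻¹ * g * s ∈ H}, ψ ⟨(s : G)⁻¹ * g * s, s.2⟩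

/-- The action of `G` on `A ⧸ S` induced by an action of `G` on the abelian group `A`
preserving the subgroup `S`. -/
@[reducible]
def quotientAction {G A : Type*} [Group G] [AddCommGroup A] [DistribMulAction G A]
    (S : AddSubgroup A) (h : ∀ (g : G), ∀ a ∈ S, g • a ∈ S) : MulAction G (A ⧸ S) where
  smul g := QuotientAddGroup.map S S (DistribSMul.toAddMonoidHom A g) (h g)
  one_smul t := by
    induction t using QuotientAddGroup.induction_on with
    | H a => exact congrArg (QuotientAddGroup.mk (s := S)) (one_smul G a)
  mul_smul g k t := by
    induction t using QuotientAddGroup.induction_on with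
    | H a => exact congrArg (QuotientAddGroup.mk (s := S)) (mul_smul g k a)

/-! ### The Weyl group, the coweight lattice and the coroot lattice

The roots live in `M` and are regarded as linear forms on `N` by means of the perfect pairing of
`M` and `N`.  The space `N` is the space in which the Coxeter arrangement lives.  For a root system
in a Euclidean space `E`, one takes `M = N = E`, paired by the inner product. -/

variable {ι M N : Type*} [AddCommGroup M] [Module ℝ M] [AddCommGroup N] [Module ℝ N]
  (P : RootPairing ι ℝ M N)

/-- The Weyl group, as the group of linear automorphisms of `N` generated by the
reflections `s_α : x ↦ x - α(x) α^∨`. -/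
def weylGroup : Subgroup (N ≃ₗ[ℝ] N) := Subgroup.closure (Set.range P.coreflection)

/-- The coweight lattice `Z = {x | α(x) ∈ ℤ for all roots α}`. -/
def coweightLattice : AddSubgroup N where
  carrier := {x | ∀ i, ∃ n : ℤ, P.root' i x = n}
  zero_mem' i := ⟨0, by simp⟩
  add_mem' {x y} hx hy i := by
    obtain ⟨m, hm⟩ := hx i
    obtain ⟨n, hn⟩ := hy i
    exact ⟨m + n, by rw [map_add, hm, hn]; push_cast; rfl⟩
  neg_mem' {x} hx i := by
    obtain ⟨m, hm⟩ := hx i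
    exact ⟨-m, by rw [map_neg, hm]; push_cast; rfl⟩

/-- The coroot lattice. -/
def corootLattice : AddSubgroup N := AddSubgroup.closure (Set.range P.coroot)

/-- The index of connection `f = (Z : Q^∨)`. -/
def connectionIndex : ℕ := (corootLattice P).relIndex (coweightLattice P)

variable {P}

/-- The Weyl group permutes the roots, regarded as linear forms on `N`. -/
theorem exists_root_comp (w : weylGroup P) (i : ι) :
    ∃ j, ∀ x : N, P.root' i (w • x) = P.root' j x := by
  obtain ⟨w, hw⟩ := w
  change ∃ j, ∀ x : N, P.root' i (w x) = P.root' j x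
  induction hw using Subgroup.closure_induction'' generalizing i with
  | one => exact ⟨i, fun x => rfl⟩
  | mem w hw =>
    obtain ⟨k, rfl⟩ := hw
    refine ⟨P.reflectionPerm k i, fun x => ?_⟩
    exact (P.flip.coroot'_reflection (i := k) (j := i) x)
  | inv_mem w hw =>
    obtain ⟨k, rfl⟩ := hw
    refine ⟨P.reflectionPerm k i, fun x => ?_⟩
    exact (P.flip.coroot'_reflection (i := k) (j := i) x)
  | mul v w _ _ hv hw =>
    obtain ⟨j, hj⟩ := hv i
    obtain ⟨k, hk⟩ := hw j
    exact ⟨k, fun x => (hj (w x)).trans (hk x)⟩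

theorem exists_smul_coroot (w : weylGroup P) (i : ι) :
    ∃ j, w • P.coroot i = P.coroot j := by
  obtain ⟨w, hw⟩ := w
  change ∃ j, w (P.coroot i) = P.coroot j
  induction hw using Subgroup.closure_induction'' generalizing i with
  | one => exact ⟨i, rfl⟩
  | mem w hw =>
    obtain ⟨k, rfl⟩ := hw
    exact ⟨P.reflectionPerm k i, (P.coroot_reflectionPerm k i).symm⟩
  | inv_mem w hw =>
    obtain ⟨k, rfl⟩ := hw
    exact ⟨P.reflectionPerm k i, (P.coroot_reflectionPerm k i).symm⟩
  | mul v w _ _ hv hw =>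
    obtain ⟨j, hj⟩ := hw i
    obtain ⟨k, hk⟩ := hv j
    exact ⟨k, (congrArg v hj).trans hk⟩

/-- The Weyl group of a finite root system is finite. -/
instance finite_weylGroup [Finite ι] [P.IsRootSystem] : Finite (weylGroup P) := by
  choose f hf using exists_smul_coroot (P := P)
  refine Finite.of_injective f fun v w h => ?_
  apply Subtype.ext
  apply LinearEquiv.toLinearMap_injective
  refine LinearMap.ext_on_range (v := P.coroot)
    (RootPairing.IsRootSystem.span_coroot_eq_top (P := P)) fun i => ?_
  exact (hf v i).trans ((congrArg P.coroot (congrFun h i)).trans (hf w i).symm)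

theorem smul_mem_coweightLattice (w : weylGroup P) (x : N) (hx : x ∈ coweightLattice P) :
    w • x ∈ coweightLattice P := by
  intro i
  obtain ⟨j, hj⟩ := exists_root_comp w i
  obtain ⟨n, hn⟩ := hx j
  exact ⟨n, (hj x).trans hn⟩

/-- The action of the Weyl group on the coweight lattice. -/
instance : DistribMulAction (weylGroup P) (coweightLattice P) where
  smul w x := ⟨w • (x : N), smul_mem_coweightLattice w x x.2⟩
  one_smul x := Subtype.ext (one_smul _ (x : N))
  mul_smul v w x := Subtype.ext (mul_smul v w (x : N))
  smul_zero w := Subtype.ext (smul_zero w)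
  smul_add w x y := Subtype.ext (smul_add w (x : N) (y : N))

/-! ### The complement of the Coxeter arrangement modulo `q` -/

variable (P)

/-- `Z_q = Z / qZ`, for the coweight lattice `Z`. -/
abbrev CoweightMod (q : ℕ) : Type _ :=
  coweightLattice P ⧸ (nsmulAddMonoidHom (α := coweightLattice P) q).range

/-- The action of the Weyl group on `Z / qZ`. -/
instance (q : ℕ) : MulAction (weylGroup P) (CoweightMod P q) :=
  quotientAction _ <| by
    rintro w _ ⟨y, rfl⟩
    exact ⟨w • y, (map_nsmul (DistribSMul.toAddMonoidHom (coweightLattice P) w) q y).symm⟩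

/-- `M(𝒜; q)`, the set of the classes in `Z / qZ` of those `x ∈ Z` for which no root `α` satisfies
`α(x) ≡ 0 mod q`.  (Opposite roots define the same hyperplane, so that all roots may be used in
place of the positive ones.)  It is stable under the Weyl group. -/
def arrComplement (q : ℕ) : SubMulAction (weylGroup P) (CoweightMod P q) where
  carrier := QuotientAddGroup.mk ''
    {x : coweightLattice P | ∀ i, ¬ ∃ k : ℤ, P.root' i (x : N) = (q : ℝ) * k}
  smul_mem' w := by
    rintro _ ⟨x, hx, rfl⟩
    refine ⟨w • x, fun i => ?_, rfl⟩
    obtain ⟨j, hj⟩ := exists_root_comp w i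
    rintro ⟨k, hk⟩
    exact hx j ⟨k, (hj x).symm.trans hk⟩

/-- The permutation character `χ_{𝒜,q}` of the Weyl group on `M(𝒜; q)`. -/
def arrChar (q : ℕ) : weylGroup P → ℂ := permChar (weylGroup P) (arrComplement P q)

/-! ### The fundamental alcove and its image in the torus -/

/-- The torus `T = N / Z`. -/
abbrev Torus : Type _ := N ⧸ coweightLattice P

/-- The action of the Weyl group on the torus. -/
instance : MulAction (weylGroup P) (Torus P) :=
  quotientAction _ smul_mem_coweightLattice

variable {P}

/-- The root `θ` is the highest root with respect to the simple roots `b`, the root of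
greatest height. -/
def IsHighestRoot (b : P.Base) (θ : ι) : Prop := ∀ i, b.height i ≤ b.height θ

/-- The fundamental alcove `A_∘`: the points on which the simple roots are positive and the
highest root `θ` is less than `1`. -/
def alcove (b : P.Base) (θ : ι) : Set N :=
  {x | (∀ i ∈ b.support, 0 < P.root' i x) ∧ P.root' θ x < 1}

/-- The image of the fundamental alcove in the torus. -/
def alcoveT (b : P.Base) (θ : ι) : Set (Torus P) := QuotientAddGroup.mk '' alcove b θ

/-- The isotropy group `W_{A_∘}` of the image of the fundamental alcove in the torus. -/
def alcoveStab (b : P.Base) (θ : ι) : Subgroup (weylGroup P) :=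
  MulAction.stabilizer (weylGroup P) (alcoveT b θ)

/-- The set of `q`-torsion points of the torus in the image of the fundamental alcove, which is
stable under `W_{A_∘}`. -/
def alcoveTorsion (b : P.Base) (θ : ι) (q : ℕ) : SubMulAction (alcoveStab b θ) (Torus P) where
  carrier := {t | t ∈ alcoveT b θ ∧ q • t = 0}
  smul_mem' w t ht := by
    obtain ⟨w, hw⟩ := w
    refine ⟨?_, ?_⟩
    · have h : w • t ∈ w • alcoveT b θ := Set.smul_mem_smul_set ht.1
      rw [MulAction.mem_stabilizer_iff.mp hw] at h
      exact h
    · change q • (QuotientAddGroup.map _ _ _ _ t) = 0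
      rw [← map_nsmul, ht.2, map_zero]

/-- The permutation character `χ_{A_∘,q}` of `W_{A_∘}` on the `q`-torsion points in the image of
the fundamental alcove. -/
def alcoveChar (b : P.Base) (θ : ι) (q : ℕ) : alcoveStab b θ → ℂ :=
  permChar (alcoveStab b θ) (alcoveTorsion b θ q)

/-- The Ehrhart counting function `L_{A_∘}(q) = #(q A_∘ ∩ Z)` of the fundamental alcove. -/
def alcoveEhrhart (b : P.Base) (θ : ι) (q : ℕ) : ℕ :=
  Nat.card ↥((q : ℝ) • alcove b θ ∩ (coweightLattice P : Set N))

end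

end EquivCharQuasi

/-! The affine Weyl group `W ⋉ Q^∨` acts simply transitively on the alcoves, the connected
components of the complement of the hyperplanes `α = k`, for roots `α` and integers `k`.
From this the theorem follows by counting in the torus `T = N / Z`.

* Division by `q` identifies `M(𝒜; q)` with the set of the `q`-torsion points of `T` at which no
  root is integral (`divTorus`).  By transitivity this set is the union of the Weyl group translates
  of the torsion points of `π_T(A)`, and a translate of `π_T(A)` that meets `π_T(A)` is equal to it,
  since `W ⋉ Z` permutes the alcoves.  So the permutation representation is induced from the
  stabilizer (`permChar_eq_inducedChar`).
* An element of the stabilizer is the linear part of a unique `x ↦ w x + z` that maps `A` to itself.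
  Simple transitivity means that each class of `z` in `Z / Q^∨` occurs for exactly one `w`
  (`IsHighestRoot.card_alcoveStab`).
* The projection to `T` is injective on `A`, so that the torsion points of `π_T(A)` correspond to
  the lattice points of `q A`, and the count of pairs `(w, t)` gives the last identity.

For simple transitivity, consider the group generated by the reflections in the walls of `A`.  It
moves every point into the closed alcove, because in each orbit a point nearest to a point of `A`
is there (`IsHighestRoot.exists_mem_closedAlcove`).  It acts freely, because a
minimal word in the wall reflections could be shortened by the exchange condition
(`eq_one_of_forall_mem`).  It contains the whole affine Weyl group: the reflection in `α_j = 1`, for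
`α_j` simple, is conjugate to a wall reflection, since a generic point of this hyperplane can be
moved to a wall (`IsHighestRoot.affineReflection_one_mem_wallGroup`).

The geometry of the alcove rests on one fact about the highest root `θ`, and there irreducibility is
used: for every root `α`, `θ - α` is a sum of simple roots (`IsHighestRoot.exists_eq_add`).  So all
positive roots are between `0` and `1` on `A`, and no hyperplane meets `A`. -/

namespace EquivCharQuasi

/-! ### The highest root -/

section HighestRoot

variable {ι M N : Type*} [AddCommGroup M] [Module ℝ M] [AddCommGroup N] [Module ℝ N]
  {P : RootPairing ι ℝ M N}

theorem root_eq_sum_nat_of_isPos (b : P.Base) {i : ι} (hi : b.IsPos i) :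
    ∃ f : ι → ℕ, P.root i = ∑ j ∈ b.support, f j • P.root j := by
  obtain ⟨f, -, hf | hf⟩ := b.exists_root_eq_sum_nat_or_neg i
  · exact ⟨f, hf⟩
  · exfalso
    have h : P.root i = ∑ j ∈ b.support, (fun j => -(f j : ℤ)) j • P.root j := by
      simp [hf]
    have h2 := RootPairing.Base.height_eq_sum h
    rw [RootPairing.Base.isPos_iff, h2] at hi
    have : ∑ j ∈ b.support, (fun j => -(f j : ℤ)) j ≤ 0 :=
      Finset.sum_nonpos fun j _ => by simp
    exact absurd hi this.not_gt

theorem height_add_sum_nat (b : P.Base) {i k : ι} {f : ι → ℕ}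
    (h : P.root k = P.root i + ∑ j ∈ b.support, f j • P.root j) :
    b.height k = b.height i + ∑ j ∈ b.support, (f j : ℤ) := by
  obtain ⟨g, -, -, hg⟩ := b.exists_root_eq_sum_int i
  have hk : P.root k = ∑ j ∈ b.support, (fun j => g j + (f j : ℤ)) j • P.root j := by
    rw [h, hg, ← Finset.sum_add_distrib]
    exact Finset.sum_congr rfl fun j _ => by simp [add_smul]
  rw [RootPairing.Base.height_eq_sum hk, RootPairing.Base.height_eq_sum hg,
    Finset.sum_add_distrib]

theorem pairing_eq_sum (b : P.Base) {i : ι} {f : ι → ℕ}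
    (h : P.root i = ∑ j ∈ b.support, f j • P.root j) (k : ι) :
    P.pairing i k = ∑ j ∈ b.support, f j * P.pairing j k := by
  have := congrArg (P.coroot' k) h
  simpa [map_sum] using this

/-- The root `i` is maximal for the partial order given by the cone of the simple roots. -/
def IsMaximalRoot (b : P.Base) (i : ι) : Prop :=
  ∀ (k : ι) (f : ι → ℕ), P.root k = P.root i + ∑ j ∈ b.support, f j • P.root j → k = i

theorem IsMaximalRoot.not_add (b : P.Base) {i k j : ι} (hi : IsMaximalRoot b i)
    (hj : b.IsPos j) : P.root k ≠ P.root i + P.root j := by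
  intro h
  obtain ⟨f, hf⟩ := root_eq_sum_nat_of_isPos b hj
  have := hi k f (hf ▸ h)
  subst this
  simp [P.ne_zero] at h

theorem IsHighestRoot.isPos {b : P.Base} {θ : ι} (hθ : IsHighestRoot b θ) : b.IsPos θ := by
  have : Nonempty ι := ⟨θ⟩
  obtain ⟨i, hi⟩ := b.support_nonempty
  have := hθ i
  rw [RootPairing.Base.height_one_of_mem_support hi] at this
  rw [RootPairing.Base.isPos_iff]
  omega

theorem isMaximalRoot_of_forall_height_le (b : P.Base) {i : ι}
    (h : ∀ (k : ι) (f : ι → ℕ), P.root k = P.root i + ∑ j ∈ b.support, f j • P.root j →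
      b.height k ≤ b.height i) : IsMaximalRoot b i := by
  intro k f hf
  have h1 := h k f hf
  rw [height_add_sum_nat b hf] at h1
  have h2 : ∑ j ∈ b.support, (f j : ℤ) = 0 :=
    le_antisymm (by omega) (Finset.sum_nonneg fun j _ => by positivity)
  rw [Finset.sum_eq_zero_iff_of_nonneg (fun j _ => by positivity)] at h2
  apply P.root.injective
  rw [hf, Finset.sum_eq_zero, add_zero]
  intro j hj
  have := h2 j hj
  simp only [Nat.cast_eq_zero] at this
  simp [this]

variable [Finite ι] [P.IsCrystallographic]

/-- A maximal positive root is dominant. -/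
theorem IsMaximalRoot.pairingIn_nonneg (b : P.Base) {i j : ι} (hi : IsMaximalRoot b i)
    (hpos : b.IsPos i) (hj : j ∈ b.support) : 0 ≤ P.pairingIn ℤ i j := by
  by_contra! hlt
  by_cases hneg : P.root i = - P.root j
  · let := P.indexNeg
    have : i = -j := by
      apply P.root.injective
      rw [hneg]; simp
    subst this
    rw [RootPairing.Base.IsPos.neg_iff_not] at hpos
    exact hpos (RootPairing.Base.isPos_of_mem_support hj)
  · obtain ⟨k, hk⟩ := P.root_add_root_mem_of_pairingIn_neg hlt hneg
    exact hi.not_add b (RootPairing.Base.isPos_of_mem_support hj) hk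

variable [P.IsReduced]

/-- By irreducibility, every simple root occurs in a maximal positive root: the simple roots that
occur span a subspace that is stable under the simple reflections. -/
theorem IsMaximalRoot.coeff_pos [P.IsIrreducible] (b : P.Base) {i : ι} (hi : IsMaximalRoot b i)
    (hpos : b.IsPos i) {f : ι → ℕ} (hf : P.root i = ∑ j ∈ b.support, f j • P.root j)
    {j : ι} (hj : j ∈ b.support) : 0 < f j := by
  set s : Set ι := {j | j ∈ b.support ∧ 0 < f j} with hs
  set q : Submodule ℝ M := Submodule.span ℝ (P.root '' s) with hq
  have hmem : P.root i ∈ q := by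
    rw [hf]
    refine Submodule.sum_mem _ fun j hj => ?_
    rcases Nat.eq_zero_or_pos (f j) with h0 | h0
    · simp [h0]
    · exact Submodule.smul_of_tower_mem _ _ (Submodule.subset_span ⟨j, ⟨hj, h0⟩, rfl⟩)
  have hinv : ∀ k ∈ b.support, q ∈ Module.End.invtSubmodule (P.reflection k) := by
    intro k hk
    by_cases hks : k ∈ s
    · exact Submodule.mem_invtSubmodule_reflection_of_mem _ _
        (Submodule.subset_span ⟨k, hks, rfl⟩)
    · have hfk : f k = 0 := by
        by_contra h
        exact hks ⟨hk, Nat.pos_of_ne_zero h⟩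
      have hle : ∀ l ∈ b.support, (f l : ℝ) * P.pairing l k ≤ 0 := by
        intro l hl
        rcases eq_or_ne l k with rfl | hlk
        · simp [hfk]
        · have := b.pairingIn_le_zero_of_ne hlk hl hk
          rw [← P.algebraMap_pairingIn ℤ]
          exact mul_nonpos_of_nonneg_of_nonpos (by positivity) (by simpa using this)
      have hsum : ∑ l ∈ b.support, (f l : ℝ) * P.pairing l k = 0 := by
        apply le_antisymm (Finset.sum_nonpos hle)
        rw [← pairing_eq_sum b hf, ← P.algebraMap_pairingIn ℤ]
        simpa using hi.pairingIn_nonneg b hpos hk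
      rw [Finset.sum_eq_zero_iff_of_nonpos hle] at hsum
      rw [Module.End.mem_invtSubmodule, hq, Submodule.span_le]
      rintro x hx
      obtain ⟨l, ⟨hl, hfl⟩, rfl⟩ := hx
      have h0 : P.pairing l k = 0 := by
        rcases mul_eq_zero.mp (hsum l hl) with h | h
        · simp at h; omega
        · exact h
      have : P.reflection k (P.root l) = P.root l := by
        rw [RootPairing.reflection_apply_root, h0]; simp
      change P.reflection k (P.root l) ∈ Submodule.span ℝ (P.root '' s)
      rw [this]
      exact Submodule.subset_span ⟨l, ⟨hl, hfl⟩, rfl⟩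
  have htop : q = ⊤ := by
    refine RootPairing.IsIrreducible.eq_top_of_invtSubmodule_reflection (P := P) q
      (b.forall_mem_support_invtSubmodule_iff q |>.mp hinv) ?_
    intro h
    rw [h] at hmem
    exact P.ne_zero i (by simpa using hmem)
  by_contra h
  have hjs : j ∉ s := fun h' => h h'.2
  have hsub : insert j s ⊆ (b.support : Set ι) := by
    rintro l (rfl | hl)
    · exact hj
    · exact hl.1
  have := ((linearIndepOn_insert hjs).mp (b.linearIndepOn_root.mono hsub)).2
  rw [← hq, htop] at this
  exact this trivial

/-- Two maximal positive roots have positive pairing, and so are equal: otherwise their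
difference would be a root. -/
theorem IsMaximalRoot.eq [P.IsIrreducible] (b : P.Base) {i k : ι} (hi : IsMaximalRoot b i)
    (hk : IsMaximalRoot b k) (hipos : b.IsPos i) (hkpos : b.IsPos k) : k = i := by
  obtain ⟨f, hf⟩ := root_eq_sum_nat_of_isPos b hkpos
  obtain ⟨j, hj, hji⟩ := hipos.exists_mem_support_pos_pairingIn
  have hpos : 0 < P.pairing k i := by
    rw [pairing_eq_sum b hf]
    have hnn : ∀ l ∈ b.support, 0 ≤ P.pairingIn ℤ l i := by
      intro l hl
      have := hi.pairingIn_nonneg b hipos hl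
      by_contra! h
      rw [P.pairingIn_lt_zero_iff] at h
      omega
    refine Finset.sum_pos' (fun l hl => ?_) ⟨j, hj, ?_⟩
    · rw [← P.algebraMap_pairingIn ℤ]
      exact mul_nonneg (by positivity) (by simpa using hnn l hl)
    · rw [← P.algebraMap_pairingIn ℤ]
      exact mul_pos (by exact_mod_cast hk.coeff_pos b hkpos hf hj) (by simpa using hji)
  rw [← P.algebraMap_pairingIn ℤ] at hpos
  have hpos' : 0 < P.pairingIn ℤ k i := by simpa using hpos
  by_contra hne
  obtain ⟨l, hl⟩ := P.root_sub_root_mem_of_pairingIn_pos hpos' hne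
  let := P.indexNeg
  rcases RootPairing.Base.IsPos.or_neg b l with h | h
  · exact hi.not_add b (k := k) h (by rw [hl]; abel)
  · refine hk.not_add b (k := i) h ?_
    have hneg : P.root (-l) = - P.root l := by simp
    rw [hneg, hl]; abel

/-- The difference of the highest root and any root is a sum of simple roots. -/
theorem IsHighestRoot.exists_eq_add [P.IsIrreducible] {b : P.Base} {θ : ι}
    (hθ : IsHighestRoot b θ) (i : ι) :
    ∃ f : ι → ℕ, P.root θ = P.root i + ∑ j ∈ b.support, f j • P.root j := by
  have hθm : IsMaximalRoot b θ := isMaximalRoot_of_forall_height_le b fun k _ _ => hθ k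
  let := P.indexNeg
  by_cases hi : b.IsPos i
  · let S : Set ι := {k | ∃ f : ι → ℕ, P.root k = P.root i + ∑ j ∈ b.support, f j • P.root j}
    obtain ⟨k, ⟨f, hf⟩, hk⟩ := Set.exists_max_image S b.height (Set.toFinite S)
      ⟨i, 0, by simp⟩
    have hkm : IsMaximalRoot b k := by
      refine isMaximalRoot_of_forall_height_le b fun l g hg => hk l ⟨fun j => f j + g j, ?_⟩
      rw [hg, hf, add_assoc, ← Finset.sum_add_distrib]
      simp [add_smul]
    have hkpos : b.IsPos k := by
      have := height_add_sum_nat b hf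
      have h2 : 0 ≤ ∑ j ∈ b.support, (f j : ℤ) := Finset.sum_nonneg fun j _ => by positivity
      rw [RootPairing.Base.isPos_iff] at hi ⊢
      omega
    have := hkm.eq b hθm hkpos hθ.isPos
    subst this
    exact ⟨f, hf⟩
  · rw [← RootPairing.Base.IsPos.neg_iff_not] at hi
    obtain ⟨f, hf⟩ := root_eq_sum_nat_of_isPos b hi
    obtain ⟨g, hg⟩ := root_eq_sum_nat_of_isPos b hθ.isPos
    refine ⟨fun j => f j + g j, ?_⟩
    have : P.root (-i) = - P.root i := by simp
    rw [this] at hf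
    simp only [add_smul, Finset.sum_add_distrib]
    rw [← hf, ← hg]; abel

end HighestRoot

/-! ### Affine reflections and the affine Weyl group -/

section AffineWeyl

variable {ι M N : Type*} [AddCommGroup M] [Module ℝ M] [AddCommGroup N] [Module ℝ N]

/-- The reflection in the affine hyperplane `α_i = k`, as a permutation of `N`. -/
def affineReflection (P : RootPairing ι ℝ M N) (i : ι) (k : ℤ) : Equiv.Perm N :=
  Function.Involutive.toPerm (fun x => x - (P.root' i x - k) • P.coroot i) fun x => by
    simp only [map_sub, map_smul, P.root'_coroot_eq_pairing, P.pairing_same, smul_eq_mul]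
    module

theorem affineReflection_apply (P : RootPairing ι ℝ M N) (i : ι) (k : ℤ) (x : N) :
    affineReflection P i k x = x - (P.root' i x - k) • P.coroot i := rfl

theorem affineReflection_mul_self (P : RootPairing ι ℝ M N) (i : ι) (k : ℤ) :
    affineReflection P i k * affineReflection P i k = 1 :=
  Equiv.ext fun x => (affineReflection P i k).left_inv x

theorem root'_affineReflection_self (P : RootPairing ι ℝ M N) (i : ι) (k : ℤ) (x : N) :
    P.root' i (affineReflection P i k x) - k = -(P.root' i x - k) := by
  simp only [affineReflection_apply, map_sub, map_smul, P.root'_coroot_eq_pairing,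
    P.pairing_same, smul_eq_mul]
  ring

theorem smul_mem_corootLattice {P : RootPairing ι ℝ M N} (w : weylGroup P) {q : N}
    (hq : q ∈ corootLattice P) : w • q ∈ corootLattice P := by
  induction hq using AddSubgroup.closure_induction with
  | mem x hx =>
    obtain ⟨i, rfl⟩ := hx
    obtain ⟨j, hj⟩ := exists_smul_coroot w i
    rw [hj]
    exact AddSubgroup.subset_closure ⟨j, rfl⟩
  | zero => rw [smul_zero]; exact zero_mem _
  | add x y _ _ hx hy => rw [smul_add]; exact add_mem hx hy
  | neg x _ hx => rw [smul_neg]; exact neg_mem hx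

/-- The affine Weyl group: the maps `x ↦ w x + q`, for `w` in the Weyl group and `q` in the
coroot lattice. -/
def affineWeylGroup (P : RootPairing ι ℝ M N) : Subgroup (Equiv.Perm N) where
  carrier := {g | ∃ w : weylGroup P, ∃ q ∈ corootLattice P, ∀ x, g x = w • x + q}
  one_mem' := ⟨1, 0, zero_mem _, fun x => by simp⟩
  mul_mem' := by
    rintro g h ⟨v, p, hp, hg⟩ ⟨w, q, hq, hh⟩
    refine ⟨v * w, v • q + p, add_mem (smul_mem_corootLattice v hq) hp, fun x => ?_⟩
    rw [Equiv.Perm.mul_apply, hg, hh, smul_add, mul_smul, add_assoc]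
  inv_mem' := by
    rintro g ⟨w, q, hq, hg⟩
    refine ⟨w⁻¹, -(w⁻¹ • q), neg_mem (smul_mem_corootLattice _ hq), fun x => ?_⟩
    rw [Equiv.Perm.inv_eq_iff_eq, hg]
    simp [smul_add, smul_neg]

variable {P : RootPairing ι ℝ M N}

theorem affineReflection_mem_affineWeylGroup (i : ι) (k : ℤ) :
    affineReflection P i k ∈ affineWeylGroup P := by
  refine ⟨⟨P.coreflection i, Subgroup.subset_closure (Set.mem_range_self i)⟩, k • P.coroot i,
    zsmul_mem (AddSubgroup.subset_closure (Set.mem_range_self i)) k, fun x => ?_⟩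
  change _ = P.coreflection i x + _
  rw [affineReflection_apply, P.coreflection_apply, ← Int.cast_smul_eq_zsmul ℝ]
  module

/-- A Weyl group element carries the root `j` and its coroot to the root `i` and its coroot. -/
theorem exists_root_comp_and_smul_coroot (w : weylGroup P) (i : ι) :
    ∃ j, (∀ x : N, P.root' i (w • x) = P.root' j x) ∧ w • P.coroot j = P.coroot i := by
  obtain ⟨w, hw⟩ := w
  change ∃ j, (∀ x : N, P.root' i (w x) = P.root' j x) ∧ w (P.coroot j) = P.coroot i
  induction hw using Subgroup.closure_induction'' generalizing i with
  | one => exact ⟨i, fun x => rfl, rfl⟩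
  | mem w hw =>
    obtain ⟨k, rfl⟩ := hw
    exact ⟨P.reflectionPerm k i, fun x => P.flip.coroot'_reflection (i := k) (j := i) x, by
      rw [← P.coroot_reflectionPerm, P.reflectionPerm_self]⟩
  | inv_mem w hw =>
    obtain ⟨k, rfl⟩ := hw
    exact ⟨P.reflectionPerm k i, fun x => P.flip.coroot'_reflection (i := k) (j := i) x, by
      rw [RootPairing.coreflection_inv, ← P.coroot_reflectionPerm, P.reflectionPerm_self]⟩
  | mul v w _ _ hv hw =>
    obtain ⟨j, hj, hj'⟩ := hv i
    obtain ⟨k, hk, hk'⟩ := hw j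
    exact ⟨k, fun x => (hj (w x)).trans (hk x), (congrArg v hk').trans hj'⟩

theorem corootLattice_le_coweightLattice [P.IsCrystallographic] :
    corootLattice P ≤ coweightLattice P := by
  rw [corootLattice, AddSubgroup.closure_le]
  rintro _ ⟨j, rfl⟩ i
  exact ⟨P.pairingIn ℤ i j, by
    rw [P.root'_coroot_eq_pairing, ← P.algebraMap_pairingIn ℤ]; rfl⟩

/-- Affine Weyl group elements permute the affine roots `α_i - k`, and the reflections
accordingly. -/
theorem exists_affineRoot_comp [P.IsCrystallographic] {g : Equiv.Perm N}
    (hg : g ∈ affineWeylGroup P) (i : ι) (k : ℤ) :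
    ∃ (j : ι) (l : ℤ), (∀ x, P.root' i (g x) - k = P.root' j x - l) ∧
      affineReflection P i k * g = g * affineReflection P j l := by
  obtain ⟨w, q, hq, hg⟩ := hg
  obtain ⟨j, hj, hj'⟩ := exists_root_comp_and_smul_coroot w i
  obtain ⟨n, hn⟩ := corootLattice_le_coweightLattice hq i
  have h1 : ∀ x, P.root' i (g x) - k = P.root' j x - (k - n : ℤ) := fun x => by
    rw [hg, map_add, hj, hn]; push_cast; ring
  refine ⟨j, k - n, h1, Equiv.ext fun x => ?_⟩
  rw [Equiv.Perm.mul_apply, Equiv.Perm.mul_apply, affineReflection_apply, h1,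
    affineReflection_apply, hg, hg, smul_sub, smul_comm, hj']
  abel

theorem eq_of_forall_root'_eq [P.IsRootSystem] {x y : N} (h : ∀ i, P.root' i x = P.root' i y) :
    x = y := by
  rw [← sub_eq_zero, RootPairing.eq_zero_iff_forall_coroot'_eq_zero P.flip]
  intro i
  change P.root' i (x - y) = 0
  rw [map_sub, h, sub_self]

theorem exists_forall_root'_eq [P.IsRootSystem] (b : P.Base) (c : ι → ℝ) :
    ∃ p : N, ∀ i ∈ b.support, P.root' i p = c i := by
  let φ : Module.Dual ℝ M := b.toWeightBasis.constr ℝ fun i => c i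
  refine ⟨P.flip.toPerfPair.symm φ, fun i hi => ?_⟩
  have h : P.flip.toPerfPair (P.flip.toPerfPair.symm φ) (P.root i) = φ (P.root i) := by
    rw [LinearEquiv.apply_symm_apply]
  refine h.trans ?_
  have : P.root i = b.toWeightBasis ⟨i, hi⟩ := by simp
  rw [this, Module.Basis.constr_basis]

end AffineWeyl

/-! ### The fundamental alcove and its walls -/

section Alcove

variable {ι M N : Type*} [AddCommGroup M] [Module ℝ M] [AddCommGroup N] [Module ℝ N]
  {P : RootPairing ι ℝ M N}

/-- The walls of the fundamental alcove, as affine roots `α_i - k` that are positive on it: the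
simple roots `α_i - 0`, and `1 - θ`, which is `α_i - k` for `α_i = -θ` and `k = -1`. -/
def IsWall (b : P.Base) (θ : ι) (i : ι) (k : ℤ) : Prop :=
  (i ∈ b.support ∧ k = 0) ∨ (i = P.reflectionPerm θ θ ∧ k = -1)

theorem root'_reflectionPerm_self (i : ι) (x : N) :
    P.root' (P.reflectionPerm i i) x = - P.root' i x := by
  simp [RootPairing.root']

theorem mem_alcove_iff {b : P.Base} {θ : ι} {x : N} :
    x ∈ alcove b θ ↔ ∀ i k, IsWall b θ i k → (k : ℝ) < P.root' i x := by
  constructor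
  · rintro ⟨h1, h2⟩ i k (⟨hi, rfl⟩ | ⟨rfl, rfl⟩)
    · simpa using h1 i hi
    · rw [root'_reflectionPerm_self]; push_cast; linarith
  · refine fun h => ⟨fun i hi => by simpa using h i 0 (Or.inl ⟨hi, rfl⟩), ?_⟩
    have := h _ _ (Or.inr ⟨rfl, rfl⟩)
    rw [root'_reflectionPerm_self] at this
    push_cast at this
    linarith

/-- The closed fundamental alcove. -/
def closedAlcove (b : P.Base) (θ : ι) : Set N :=
  {x | (∀ i ∈ b.support, 0 ≤ P.root' i x) ∧ P.root' θ x ≤ 1}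

theorem mem_closedAlcove_iff {b : P.Base} {θ : ι} {x : N} :
    x ∈ closedAlcove b θ ↔ ∀ i k, IsWall b θ i k → (k : ℝ) ≤ P.root' i x := by
  constructor
  · rintro ⟨h1, h2⟩ i k (⟨hi, rfl⟩ | ⟨rfl, rfl⟩)
    · simpa using h1 i hi
    · rw [root'_reflectionPerm_self]; push_cast; linarith
  · refine fun h => ⟨fun i hi => by simpa using h i 0 (Or.inl ⟨hi, rfl⟩), ?_⟩
    have := h _ _ (Or.inr ⟨rfl, rfl⟩)
    rw [root'_reflectionPerm_self] at this
    push_cast at this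
    linarith

theorem alcove_subset_closedAlcove (b : P.Base) (θ : ι) : alcove b θ ⊆ closedAlcove b θ :=
  fun _ hx => ⟨fun i hi => (hx.1 i hi).le, hx.2.le⟩

theorem root'_eq_add_sum (b : P.Base) {i k : ι} {f : ι → ℕ}
    (h : P.root k = P.root i + ∑ j ∈ b.support, f j • P.root j) (x : N) :
    P.root' k x = P.root' i x + ∑ j ∈ b.support, f j * P.root' j x := by
  have := congrArg (fun m => P.toLinearMap m x) h
  simpa [RootPairing.root', map_sum, LinearMap.sum_apply] using this

theorem root'_eq_sum (b : P.Base) {i : ι} {f : ι → ℕ}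
    (h : P.root i = ∑ j ∈ b.support, f j • P.root j) (x : N) :
    P.root' i x = ∑ j ∈ b.support, f j * P.root' j x := by
  have := congrArg (fun m => P.toLinearMap m x) h
  simpa [RootPairing.root', map_sum, LinearMap.sum_apply] using this

theorem root'_nonneg_of_isPos {b : P.Base} {x : N} (hx : ∀ i ∈ b.support, 0 ≤ P.root' i x)
    {i : ι} (hi : b.IsPos i) : 0 ≤ P.root' i x := by
  obtain ⟨f, hf⟩ := root_eq_sum_nat_of_isPos b hi
  rw [root'_eq_sum b hf]
  exact Finset.sum_nonneg fun j hj => mul_nonneg (by positivity) (hx j hj)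

theorem root'_pos_of_isPos {b : P.Base} {x : N} (hx : ∀ i ∈ b.support, 0 < P.root' i x)
    {i : ι} (hi : b.IsPos i) : 0 < P.root' i x := by
  obtain ⟨f, hf⟩ := root_eq_sum_nat_of_isPos b hi
  rw [root'_eq_sum b hf]
  have hnn : ∀ j ∈ b.support, 0 ≤ (f j : ℝ) * P.root' j x := fun j hj =>
    mul_nonneg (by positivity) (hx j hj).le
  refine (Finset.sum_nonneg hnn).lt_of_ne' fun h0 => P.ne_zero i ?_
  rw [Finset.sum_eq_zero_iff_of_nonneg hnn] at h0
  rw [hf]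
  refine Finset.sum_eq_zero fun j hj => ?_
  have := (mul_eq_zero.mp (h0 j hj)).resolve_right (hx j hj).ne'
  rw [Nat.cast_eq_zero] at this
  simp [this]

theorem isPos_or_isPos_reflectionPerm (b : P.Base) (i : ι) :
    b.IsPos i ∨ b.IsPos (P.reflectionPerm i i) := RootPairing.Base.IsPos.or_neg b i

/-- If `x` is in general position on the wall of the dominant chamber that is given by the simple
root `j`, then `j` is the only positive root that vanishes at `x`. -/
theorem eq_of_isPos_of_root'_eq_zero [Finite ι] [P.IsReduced] {b : P.Base} {x : N} {i j : ι}
    (hi : b.IsPos i) (hj : j ∈ b.support)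
    (hx : ∀ k ∈ b.support, k ≠ j → 0 < P.root' k x) (hjx : P.root' j x = 0)
    (h : P.root' i x = 0) : i = j := by
  obtain ⟨f, hf⟩ := root_eq_sum_nat_of_isPos b hi
  rw [root'_eq_sum b hf, Finset.sum_eq_zero_iff_of_nonneg] at h
  · have h0 : ∀ k ∈ b.support, k ≠ j → f k • P.root k = 0 := by
      intro k hk hkj
      have := (mul_eq_zero.mp (h k hk)).resolve_right (hx k hk hkj).ne'
      rw [Nat.cast_eq_zero] at this
      simp [this]
    rw [Finset.sum_eq_single_of_mem j hj h0] at hf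
    have hf' : P.root i = (f j : ℝ) • P.root j := by rw [hf, Nat.cast_smul_eq_nsmul]
    have hone : (f j : ℝ) = 1 ∨ (f j : ℝ) = -1 := by
      have : IsAddTorsionFree M := .of_isTorsionFree ℝ M
      have : IsAddTorsionFree N := .of_isTorsionFree ℝ N
      exact b.eq_one_or_neg_one_of_mem_support_of_smul_mem j hj _ ⟨i, hf'⟩
    rcases hone with h1 | h1
    · exact P.root.injective (by rw [hf', h1, one_smul])
    · have : (0 : ℝ) ≤ f j := by positivity
      linarith
  · intro k hk
    rcases eq_or_ne k j with rfl | hkj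
    · rw [hjx, mul_zero]
    · exact mul_nonneg (by positivity) (hx k hk hkj).le

theorem IsHighestRoot.alcove_nonempty [P.IsRootSystem] {b : P.Base} {θ : ι}
    (hθ : IsHighestRoot b θ) : (alcove b θ).Nonempty := by
  obtain ⟨f, hf⟩ := root_eq_sum_nat_of_isPos b hθ.isPos
  have hS0 : 0 ≤ ∑ j ∈ b.support, (f j : ℝ) := Finset.sum_nonneg fun j _ => by positivity
  obtain ⟨p, hp⟩ := exists_forall_root'_eq b fun _ => (∑ j ∈ b.support, (f j : ℝ) + 1)⁻¹
  refine ⟨p, fun i hi => by rw [hp i hi]; positivity, ?_⟩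
  rw [root'_eq_sum b hf, Finset.sum_congr rfl fun j hj => by rw [hp j hj], ← Finset.sum_mul,
    ← div_eq_mul_inv, div_lt_one (by positivity)]
  linarith

section Highest

variable [Finite ι] [P.IsCrystallographic] [P.IsReduced] [P.IsIrreducible]
  {b : P.Base} {θ : ι} (hθ : IsHighestRoot b θ)

include hθ

theorem IsHighestRoot.root'_le {x : N} (hx : ∀ i ∈ b.support, 0 ≤ P.root' i x) (i : ι) :
    P.root' i x ≤ P.root' θ x := by
  obtain ⟨f, hf⟩ := hθ.exists_eq_add i
  rw [root'_eq_add_sum b hf]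
  have : 0 ≤ ∑ j ∈ b.support, (f j : ℝ) * P.root' j x :=
    Finset.sum_nonneg fun j hj => mul_nonneg (by positivity) (hx j hj)
  linarith

theorem IsHighestRoot.eq_of_root'_eq {x : N} (hx : ∀ i ∈ b.support, 0 < P.root' i x) {i : ι}
    (h : P.root' i x = P.root' θ x) : i = θ := by
  obtain ⟨f, hf⟩ := hθ.exists_eq_add i
  rw [root'_eq_add_sum b hf, left_eq_add, Finset.sum_eq_zero_iff_of_nonneg
    fun j hj => mul_nonneg (by positivity) (hx j hj).le] at h
  apply P.root.injective
  rw [hf, Finset.sum_eq_zero, add_zero]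
  intro j hj
  have := (mul_eq_zero.mp (h j hj)).resolve_right (hx j hj).ne'
  rw [Nat.cast_eq_zero] at this
  simp [this]

theorem IsHighestRoot.root'_mem_Ioo {x : N} (hx : x ∈ alcove b θ) {i : ι} (hi : b.IsPos i) :
    P.root' i x ∈ Set.Ioo (0 : ℝ) 1 :=
  ⟨root'_pos_of_isPos hx.1 hi, (hθ.root'_le (fun j hj => (hx.1 j hj).le) i).trans_lt hx.2⟩

theorem IsHighestRoot.root'_mem_Icc {x : N} (hx : x ∈ closedAlcove b θ) {i : ι}
    (hi : b.IsPos i) : P.root' i x ∈ Set.Icc (0 : ℝ) 1 :=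
  ⟨root'_nonneg_of_isPos hx.1 hi, (hθ.root'_le hx.1 i).trans hx.2⟩

/-- No root takes an integral value on the fundamental alcove. -/
theorem IsHighestRoot.root'_ne_intCast {x : N} (hx : x ∈ alcove b θ) (i : ι) (k : ℤ) :
    P.root' i x ≠ k := by
  intro h
  rcases isPos_or_isPos_reflectionPerm b i with hi | hi
  · obtain ⟨h1, h2⟩ := hθ.root'_mem_Ioo hx hi
    rw [h] at h1 h2
    norm_cast at h1 h2
    omega
  · obtain ⟨h1, h2⟩ := hθ.root'_mem_Ioo hx hi
    rw [root'_reflectionPerm_self, h] at h1 h2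
    norm_cast at h1 h2
    omega

/-- An affine root that is positive at a point of the fundamental alcove is nonnegative on the
closed alcove. -/
theorem IsHighestRoot.le_root'_of_lt {a x : N} (ha : a ∈ alcove b θ) (hx : x ∈ closedAlcove b θ)
    {i : ι} {k : ℤ} (h : k < P.root' i a) : k ≤ P.root' i x := by
  rcases isPos_or_isPos_reflectionPerm b i with hi | hi
  · have h1 := (hθ.root'_mem_Ioo ha hi).2
    have h2 := (hθ.root'_mem_Icc hx hi).1
    have : k < 1 := by exact_mod_cast h.trans h1
    have : (k : ℝ) ≤ 0 := by exact_mod_cast Int.lt_add_one_iff.mp this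
    linarith
  · have h1 := (hθ.root'_mem_Ioo ha hi).1
    have h2 := (hθ.root'_mem_Icc hx hi).2
    rw [root'_reflectionPerm_self] at h1 h2
    have : (k : ℝ) < 0 := by linarith
    have : k < 0 := by exact_mod_cast this
    have : (k : ℝ) ≤ -1 := by exact_mod_cast Int.le_sub_one_iff.mpr this
    linarith

theorem IsHighestRoot.root'_le_of_lt {a x : N} (ha : a ∈ alcove b θ) (hx : x ∈ closedAlcove b θ)
    {i : ι} {k : ℤ} (h : P.root' i a < k) : P.root' i x ≤ k := by
  have := hθ.le_root'_of_lt ha hx (i := P.reflectionPerm i i) (k := -k) (by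
    rw [root'_reflectionPerm_self]; push_cast; linarith)
  rw [root'_reflectionPerm_self] at this
  push_cast at this
  linarith

/-- Each wall contains a point of the closed alcove through which no other hyperplane passes:
an affine root that is positive on the alcove and vanishes at the point is the wall. -/
theorem IsHighestRoot.exists_mem_wall [P.IsRootSystem] {i : ι} {k : ℤ} (h : IsWall b θ i k) :
    ∃ p ∈ closedAlcove b θ, P.root' i p = k ∧ ∀ a ∈ alcove b θ, ∀ (j : ι) (l : ℤ),
      l < P.root' j a → P.root' j p = l → j = i ∧ l = k := by
  classical
  obtain ⟨f, hf⟩ := root_eq_sum_nat_of_isPos b hθ.isPos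
  set S : ℝ := ∑ j ∈ b.support, (f j : ℝ) with hS
  have hS0 : 0 ≤ S := Finset.sum_nonneg fun j _ => by positivity
  rcases h with ⟨hi, rfl⟩ | ⟨rfl, rfl⟩
  -- let `α_i` vanish at the point, and the other simple roots be so small that `θ < 1`
  · obtain ⟨p, hp⟩ := exists_forall_root'_eq b fun j => if j = i then 0 else (S + 1)⁻¹
    have hpi : P.root' i p = 0 := by simp [hp i hi]
    have hp0 : ∀ j ∈ b.support, j ≠ i → 0 < P.root' j p := fun j hj hji => by
      rw [hp j hj, if_neg hji]; positivity
    have hpnn : ∀ j ∈ b.support, 0 ≤ P.root' j p := fun j hj => by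
      rcases eq_or_ne j i with rfl | hji
      · exact hpi.ge
      · exact (hp0 j hj hji).le
    have hpθ : P.root' θ p < 1 := by
      have : P.root' θ p ≤ S * (S + 1)⁻¹ := by
        rw [root'_eq_sum b hf, hS, Finset.sum_mul]
        refine Finset.sum_le_sum fun j hj => mul_le_mul_of_nonneg_left ?_ (by positivity)
        rw [hp j hj]
        split_ifs
        · positivity
        · exact le_rfl
      refine this.trans_lt ?_
      rw [← div_eq_mul_inv, div_lt_one (by positivity)]
      linarith
    have hzero : ∀ j, b.IsPos j → ∀ l : ℤ, P.root' j p = l → j = i ∧ l = 0 := by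
      intro j hj l hl
      have h1 := root'_nonneg_of_isPos hpnn hj
      have h2 := (hθ.root'_le hpnn j).trans_lt hpθ
      rw [hl] at h1 h2
      norm_cast at h1 h2
      obtain rfl : l = 0 := by omega
      exact ⟨eq_of_isPos_of_root'_eq_zero hj hi hp0 hpi (by simpa using hl), rfl⟩
    refine ⟨p, ⟨hpnn, hpθ.le⟩, by simpa using hpi, fun a ha j l hla hlp => ?_⟩
    rcases isPos_or_isPos_reflectionPerm b j with hj | hj
    · exact hzero j hj l hlp
    · obtain ⟨rfl, hl⟩ := hzero _ hj (-l) (by rw [root'_reflectionPerm_self, hlp]; push_cast; rfl)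
      obtain rfl : l = 0 := by omega
      have := ha.1 _ hi
      rw [root'_reflectionPerm_self] at this
      push_cast at hla
      linarith
  -- let all simple roots take the same value at the point, so chosen that `θ = 1`
  · have hSpos : 0 < S := by
      obtain ⟨p, hp⟩ := exists_forall_root'_eq b fun _ => 1
      have := root'_pos_of_isPos (x := p) (fun j hj => by rw [hp j hj]; exact one_pos) hθ.isPos
      rwa [root'_eq_sum b hf, Finset.sum_congr rfl fun j hj => by rw [hp j hj, mul_one]] at this
    obtain ⟨p, hp⟩ := exists_forall_root'_eq b fun _ => S⁻¹
    have hp0 : ∀ j ∈ b.support, 0 < P.root' j p := fun j hj => by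
      rw [hp j hj]; positivity
    have hpθ : P.root' θ p = 1 := by
      rw [root'_eq_sum b hf, Finset.sum_congr rfl fun j hj => by rw [hp j hj], ← Finset.sum_mul]
      exact mul_inv_cancel₀ hSpos.ne'
    have hone : ∀ j, b.IsPos j → ∀ l : ℤ, P.root' j p = l → l = 1 := by
      intro j hj l hl
      have h1 := root'_pos_of_isPos hp0 hj
      have h2 := hθ.root'_le (fun j hj => (hp0 j hj).le) j
      rw [hl] at h1
      rw [hl, hpθ] at h2
      norm_cast at h1 h2
      omega
    refine ⟨p, ⟨fun j hj => (hp0 j hj).le, hpθ.le⟩, ?_, fun a ha j l hla hlp => ?_⟩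
    · rw [root'_reflectionPerm_self, hpθ]; simp
    rcases isPos_or_isPos_reflectionPerm b j with hj | hj
    · obtain rfl := hone j hj l hlp
      have := (hθ.root'_mem_Ioo ha hj).2
      push_cast at hla
      linarith
    · have hlp' : P.root' (P.reflectionPerm j j) p = (-l : ℤ) := by
        rw [root'_reflectionPerm_self, hlp]; push_cast; rfl
      have hl := hone _ hj (-l) hlp'
      have hjθ : P.reflectionPerm j j = θ := by
        refine hθ.eq_of_root'_eq hp0 ?_
        rw [hlp', hl, hpθ]; simp
      refine ⟨?_, by omega⟩
      apply P.root.injective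
      have : P.root θ = - P.root j := by rw [← hjθ]; simp
      rw [P.root_reflectionPerm, P.reflection_apply_self, this, neg_neg]

end Highest

end Alcove

/-! ### The exchange condition -/

section Exchange

variable {G I : Type*} [Group G]

/-- The exchange condition, for a group with involutions `s i` and "positive sides"
`D i ∋ 1`, such that if `h` and `h * s j` lie on different sides of the wall `i`, then `h`
conjugates `s j` to `s i`. -/
theorem exists_shorter_list {s : I → G} {D : I → Set G}
    (hs : ∀ i, s i * s i = 1) (h1 : ∀ i, 1 ∈ D i)
    (hconj : ∀ i j, ∀ h ∈ Subgroup.closure (Set.range s), h ∈ D i → h * s j ∉ D i →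
      s i * h = h * s j)
    (i : I) (L : List I) (hD : (L.map s).prod ∉ D i) :
    ∃ L' : List I, L'.length < L.length ∧ (L'.map s).prod = s i * (L.map s).prod := by
  induction L using List.reverseRecOn with
  | nil => exact absurd (h1 i) hD
  | append_singleton L j ih =>
    by_cases hLD : (L.map s).prod ∈ D i
    · refine ⟨L, by simp, ?_⟩
      have hmem : (L.map s).prod ∈ Subgroup.closure (Set.range s) := by
        refine Subgroup.list_prod_mem _ fun u hu => ?_
        obtain ⟨j, -, rfl⟩ := List.mem_map.mp hu
        exact Subgroup.subset_closure (Set.mem_range_self j)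
      rw [List.map_append, List.prod_append, List.map_singleton, List.prod_singleton] at hD ⊢
      rw [← mul_assoc, hconj i j _ hmem hLD hD, mul_assoc, hs j, mul_one]
    · obtain ⟨L', hlen, hprod⟩ := ih hLD
      exact ⟨L' ++ [j], by simpa using hlen, by simp [hprod, mul_assoc]⟩

/-- Under the exchange condition, only the neutral element lies on the positive side of every
wall. -/
theorem eq_one_of_forall_mem {s : I → G} {D : I → Set G}
    (hs : ∀ i, s i * s i = 1) (h1 : ∀ i, 1 ∈ D i)
    (hflip : ∀ i, ∀ h ∈ D i, s i * h ∉ D i)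
    (hconj : ∀ i j, ∀ h ∈ Subgroup.closure (Set.range s), h ∈ D i → h * s j ∉ D i →
      s i * h = h * s j)
    {g : G} (hg : g ∈ Subgroup.closure (Set.range s)) (hgD : ∀ i, g ∈ D i) : g = 1 := by
  have hex : ∃ L : List I, (L.map s).prod = g := by
    clear hgD
    induction hg using Subgroup.closure_induction_left with
    | one => exact ⟨[], rfl⟩
    | mul_left x hx y hy ih =>
      obtain ⟨i, rfl⟩ := hx
      obtain ⟨L, rfl⟩ := ih
      exact ⟨i :: L, by simp⟩
    | inv_mul_cancel x hx y hy ih =>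
      obtain ⟨i, rfl⟩ := hx
      obtain ⟨L, rfl⟩ := ih
      exact ⟨i :: L, by simp [← eq_inv_of_mul_eq_one_left (hs i)]⟩
  obtain ⟨L, rfl⟩ := hex
  induction hn : L.length using Nat.strong_induction_on generalizing L with
  | _ n ih =>
    match L, hn with
    | [], _ => rfl
    | i :: L, hn =>
      have hD : (L.map s).prod ∉ D i := by
        have := hflip i _ (hgD i)
        rwa [List.map_cons, List.prod_cons, ← mul_assoc, hs i, one_mul] at this
      -- the exchange replaces the word `i :: L` by a shorter one for the same element
      obtain ⟨L', hlen, hprod⟩ := exists_shorter_list hs h1 hconj i L hD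
      rw [List.map_cons, List.prod_cons, ← hprod] at hg hgD ⊢
      exact ih _ (by simp at hn; omega) L' hg hgD rfl

end Exchange

/-! ### The group generated by the wall reflections -/

section WallGroup

variable {ι M N : Type*} [AddCommGroup M] [Module ℝ M] [AddCommGroup N] [Module ℝ N]
  {P : RootPairing ι ℝ M N}

/-- The group generated by the reflections in the walls of the fundamental alcove. -/
def wallGroup (b : P.Base) (θ : ι) : Subgroup (Equiv.Perm N) :=
  Subgroup.closure
    (Set.range fun w : {w : ι × ℤ // IsWall b θ w.1 w.2} => affineReflection P w.1.1 w.1.2)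

theorem affineReflection_mem_wallGroup {b : P.Base} {θ i : ι} {k : ℤ} (h : IsWall b θ i k) :
    affineReflection P i k ∈ wallGroup b θ :=
  Subgroup.subset_closure ⟨⟨(i, k), h⟩, rfl⟩

theorem wallGroup_le_affineWeylGroup (b : P.Base) (θ : ι) :
    wallGroup b θ ≤ affineWeylGroup P := by
  rw [wallGroup, Subgroup.closure_le]
  rintro _ ⟨w, rfl⟩
  exact affineReflection_mem_affineWeylGroup _ _

/-- The affine Weyl group orbit of a point meets a bounded region in a finite set. -/
theorem finite_orbit_inter_bounded [Finite ι] [P.IsRootSystem] [P.IsCrystallographic] (x : N)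
    (R : ℝ) : {y | (∃ g ∈ affineWeylGroup P, g x = y) ∧ ∀ i, |P.root' i y| ≤ R}.Finite := by
  -- the values in `[-R, R]` that a root can take on the orbit are of the form `α_j x - n`
  let V : Set ℝ :=
    ⋃ j, (fun n : ℤ => P.root' j x - n) '' Set.Icc ⌊P.root' j x - R⌋ ⌈P.root' j x + R⌉
  have hV : V.Finite := Set.finite_iUnion fun j => (Set.finite_Icc _ _).image _
  refine Set.Finite.of_finite_image (f := fun y i => P.root' i y)
    ((Set.Finite.pi' fun _ : ι => hV).subset ?_) ?_
  · rintro _ ⟨_, ⟨⟨g, hg, rfl⟩, hR⟩, rfl⟩ i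
    obtain ⟨j, l, h, -⟩ := exists_affineRoot_comp hg i 0
    have h := h x
    rw [Int.cast_zero, sub_zero] at h
    refine Set.mem_iUnion.mpr ⟨j, l, ⟨?_, ?_⟩, h.symm⟩
    · have := abs_le.mp (hR i)
      rw [h] at this
      have : (⌊P.root' j x - R⌋ : ℝ) ≤ l := (Int.floor_le _).trans (by linarith)
      exact_mod_cast this
    · have := abs_le.mp (hR i)
      rw [h] at this
      have : (l : ℝ) ≤ ⌈P.root' j x + R⌉ := le_trans (by linarith) (Int.le_ceil _)
      exact_mod_cast this
  · intro y _ z _ hyz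
    exact eq_of_forall_root'_eq fun i => congrFun hyz i

/-- The change of the distance to `a` under the reflection in the hyperplane `α_i = k`. -/
theorem corootForm_affineReflection_sub [Fintype ι] (i : ι) (k : ℤ) (y a : N) :
    P.CorootForm (affineReflection P i k y - a) (affineReflection P i k y - a) =
      P.CorootForm (y - a) (y - a) +
        (P.root' i y - k) * (P.root' i a - k) * P.CorootForm (P.coroot i) (P.coroot i) := by
  have h : ∀ v, P.CorootForm (P.coroot i) (P.coroot i) * P.root' i v =
      2 * P.CorootForm (P.coroot i) v := by
    intro v
    have := congrArg (fun m => P.toLinearMap m v) (P.corootForm_self_smul_root i)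
    simpa only [map_smul, map_nsmul, P.toLinearMap_apply_CoPolarization, LinearMap.smul_apply,
      smul_eq_mul, nsmul_eq_mul, Nat.cast_ofNat] using this
  have hexp : ∀ (u e : N) (c : ℝ), P.CorootForm (u - c • e) (u - c • e) =
      P.CorootForm u u - 2 * c * P.CorootForm e u + c ^ 2 * P.CorootForm e e := by
    intro u e c
    have hsymm : P.CorootForm u e = P.CorootForm e u := by
      simp only [P.corootForm_apply_apply, mul_comm]
    simp only [map_sub, map_smul, LinearMap.sub_apply, LinearMap.smul_apply, smul_eq_mul, hsymm]
    ring
  have h1 := h (y - a)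
  have h2 : affineReflection P i k y - a = (y - a) - (P.root' i y - k) • P.coroot i := by
    rw [affineReflection_apply]; abel
  rw [h2, hexp]
  rw [map_sub (P.root' i)] at h1
  linear_combination (P.root' i y - k) * h1

theorem corootForm_coroot_pos [Fintype ι] (i : ι) : 0 < P.CorootForm (P.coroot i) (P.coroot i) := by
  rw [P.corootForm_apply_apply]
  refine Finset.sum_pos' (fun j _ => mul_self_nonneg _) ⟨i, Finset.mem_univ _, ?_⟩
  rw [P.root'_coroot_eq_pairing, P.pairing_same]
  norm_num

/-- The group generated by the wall reflections moves every point into the closed alcove: among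
the points of an orbit, one nearest to a point of the alcove lies on the positive side of each
wall, since otherwise the reflection in that wall would bring it nearer. -/
theorem IsHighestRoot.exists_mem_closedAlcove [Finite ι] [P.IsRootSystem] [P.IsCrystallographic]
    {b : P.Base} {θ : ι} (hθ : IsHighestRoot b θ) (x : N) :
    ∃ g ∈ wallGroup b θ, g x ∈ closedAlcove b θ := by
  have := Fintype.ofFinite ι
  obtain ⟨a, ha⟩ := hθ.alcove_nonempty
  let D : N → ℝ := fun y => P.CorootForm (y - a) (y - a)
  let O : Set N := {y | (∃ g ∈ wallGroup b θ, g x = y) ∧ D y ≤ D x}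
  have hO : O.Finite := by
    obtain ⟨R, hR⟩ : ∃ R : ℝ, ∀ y, D y ≤ D x → ∀ i, |P.root' i y| ≤ R := by
      refine ⟨∑ j, |P.root' j a| + (D x + 1), fun y hy i => ?_⟩
      have h1 : (P.root' i (y - a)) ^ 2 ≤ D y := by
        simp only [D, P.corootForm_apply_apply, pow_two]
        exact Finset.single_le_sum (f := fun i => P.root' i (y - a) * P.root' i (y - a))
          (fun j _ => mul_self_nonneg _) (Finset.mem_univ i)
      have h2 : |P.root' i (y - a)| ≤ D x + 1 := by
        rw [abs_le]
        constructor <;>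
          nlinarith [sq_nonneg (P.root' i (y - a) + 1), sq_nonneg (P.root' i (y - a) - 1)]
      have h3 : |P.root' i a| ≤ ∑ j, |P.root' j a| :=
        Finset.single_le_sum (f := fun j => |P.root' j a|) (fun j _ => abs_nonneg _)
          (Finset.mem_univ i)
      have h4 : P.root' i y = P.root' i a + P.root' i (y - a) := by rw [map_sub]; ring
      rw [h4]
      exact (abs_add_le _ _).trans (add_le_add h3 h2)
    refine (finite_orbit_inter_bounded (P := P) x R).subset ?_
    rintro y ⟨⟨g, hg, rfl⟩, hy⟩
    exact ⟨⟨g, wallGroup_le_affineWeylGroup b θ hg, rfl⟩, hR _ hy⟩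
  obtain ⟨y, ⟨⟨g, hg, rfl⟩, hgx⟩, hmin⟩ := Set.exists_min_image O D hO
    ⟨x, ⟨1, one_mem _, rfl⟩, le_rfl⟩
  refine ⟨g, hg, mem_closedAlcove_iff.mpr fun i k hik => ?_⟩
  by_contra! hlt
  have hc := corootForm_affineReflection_sub (P := P) i k (g x) a
  have hneg : D (affineReflection P i k (g x)) < D (g x) := by
    simp only [D]
    rw [hc]
    have h1 := mem_alcove_iff.mp ha i k hik
    have := mul_neg_of_neg_of_pos (mul_neg_of_neg_of_pos (sub_neg.mpr hlt) (sub_pos.mpr h1))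
      (corootForm_coroot_pos (P := P) i)
    linarith
  exact hneg.not_ge (hmin _ ⟨⟨affineReflection P i k * g,
    mul_mem (affineReflection_mem_wallGroup hik) hg, rfl⟩, hneg.le.trans hgx⟩)

variable [Finite ι] [P.IsRootSystem] [P.IsCrystallographic] [P.IsReduced] [P.IsIrreducible]
  {b : P.Base} {θ : ι} (hθ : IsHighestRoot b θ)

include hθ

/-- Let `h` be in the affine Weyl group, and let `s` be the reflection in the wall `α_j = l` of the
alcove `A`.  If `h A` and `h s A` lie on different sides of the hyperplane `α_i = k`, then this
hyperplane is the image of the wall under `h`.  Indeed its inverse image under `h` separates `A`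
from `s A`, so it passes through the points of the wall, one of which lies on no other
hyperplane. -/
theorem IsHighestRoot.affineReflection_mul_eq {a : N} (ha : a ∈ alcove b θ) {i j : ι} {k l : ℤ}
    (hj : IsWall b θ j l) {h : Equiv.Perm N} (hh : h ∈ affineWeylGroup P)
    (h1 : k < P.root' i (h a))
    (h2 : P.root' i (h (affineReflection P j l a)) ≤ k) :
    affineReflection P i k * h = h * affineReflection P j l := by
  obtain ⟨m, n, hmn, hrefl⟩ := exists_affineRoot_comp hh i k
  obtain ⟨p, hp, hpj, huniq⟩ := hθ.exists_mem_wall hj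
  have e1 : n < P.root' m a := by linarith [hmn a]
  have e2 : P.root' m (affineReflection P j l a) ≤ n := by
    linarith [hmn (affineReflection P j l a)]
  -- `α_u - v` is the affine root `α_m - n` reflected in the wall, so it is negative on `A`
  obtain ⟨u, v, huv, -⟩ := exists_affineRoot_comp
    (affineReflection_mem_affineWeylGroup (P := P) j l) m n
  have e3 : P.root' u a < v :=
    lt_of_le_of_ne (by linarith [huv a]) (hθ.root'_ne_intCast ha u v)
  have hfix : affineReflection P j l p = p := by
    rw [affineReflection_apply, hpj, sub_self, zero_smul, sub_zero]
  have e4 := hθ.le_root'_of_lt ha hp e1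
  have e5 := hθ.root'_le_of_lt ha hp e3
  have e6 := huv p
  rw [hfix] at e6
  obtain ⟨rfl, rfl⟩ := huniq a ha m n e1 (by linarith)
  exact hrefl

/-- The group generated by the wall reflections acts freely on the alcoves: the exchange condition
holds for the sets `D` of the `h` with `h A` on the same side of a given wall as `A`. -/
theorem IsHighestRoot.eq_one_of_mem_wallGroup {a : N} (ha : a ∈ alcove b θ) {g : Equiv.Perm N}
    (hg : g ∈ wallGroup b θ) (hga : g a ∈ alcove b θ) : g = 1 := by
  refine eq_one_of_forall_mem
    (s := fun w : {w : ι × ℤ // IsWall b θ w.1 w.2} => affineReflection P w.1.1 w.1.2)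
    (D := fun w => {h | (w.1.2 : ℝ) < P.root' w.1.1 (h a)})
    (fun w => affineReflection_mul_self P _ _) (fun w => mem_alcove_iff.mp ha _ _ w.2)
    (fun w h hw hsw => ?_) (fun v w h hh hv hvw => ?_) hg
    fun w => mem_alcove_iff.mp hga _ _ w.2
  · have := root'_affineReflection_self P w.1.1 w.1.2 (h a)
    simp only [Set.mem_ofPred_eq, Equiv.Perm.mul_apply] at hw hsw
    linarith
  · exact hθ.affineReflection_mul_eq ha w.2 (wallGroup_le_affineWeylGroup b θ hh) hv
      (not_lt.mp hvw)

end WallGroup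

/-! ### The affine Weyl group is generated by the wall reflections -/

section Generation

variable {ι M N : Type*} [AddCommGroup M] [Module ℝ M] [AddCommGroup N] [Module ℝ N]
  {P : RootPairing ι ℝ M N}

theorem affineReflection_reflectionPerm_self (i : ι) (k : ℤ) :
    affineReflection P (P.reflectionPerm i i) (-k) = affineReflection P i k := by
  ext x
  rw [affineReflection_apply, affineReflection_apply, root'_reflectionPerm_self]
  simp only [P.coroot_reflectionPerm, P.coreflection_apply_self]
  push_cast
  module

theorem affineReflection_zero_apply (i : ι) (x : N) :
    affineReflection P i 0 x = P.coreflection i x := by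
  rw [affineReflection_apply, P.coreflection_apply, Int.cast_zero, sub_zero]

theorem affineReflection_reflectionPerm (i j : ι) :
    affineReflection P (P.reflectionPerm j i) 0 =
      affineReflection P j 0 * affineReflection P i 0 * affineReflection P j 0 := by
  ext x
  have h : P.root' (P.reflectionPerm j i) x = P.root' i (P.coreflection j x) :=
    (P.flip.coroot'_reflection (i := j) (j := i) x).symm
  have hj : P.coreflection j (P.coreflection j x) = x :=
    (P.coreflection j).symm_apply_apply x
  rw [Equiv.Perm.mul_apply, Equiv.Perm.mul_apply, affineReflection_zero_apply,
    affineReflection_zero_apply, affineReflection_zero_apply, affineReflection_zero_apply,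
    P.coreflection_apply, P.coreflection_apply i, map_sub, map_smul, hj, h,
    P.coroot_reflectionPerm]

theorem mem_coweightLattice_of_forall_mem_support (b : P.Base) {x : N}
    (h : ∀ i ∈ b.support, ∃ n : ℤ, P.root' i x = n) : x ∈ coweightLattice P := by
  have hpos : ∀ i, b.IsPos i → ∃ n : ℤ, P.root' i x = n := by
    intro i hi
    obtain ⟨f, hf⟩ := root_eq_sum_nat_of_isPos b hi
    choose! n hn using h
    refine ⟨∑ j ∈ b.support, f j * n j, ?_⟩
    rw [root'_eq_sum b hf]
    push_cast
    exact Finset.sum_congr rfl fun j hj => by rw [hn j hj]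
  intro i
  rcases isPos_or_isPos_reflectionPerm b i with hi | hi
  · exact hpos i hi
  · obtain ⟨n, hn⟩ := hpos _ hi
    rw [root'_reflectionPerm_self] at hn
    exact ⟨-n, by push_cast; linarith⟩

/-- For a simple root `α_j` there is a point on the hyperplane `α_j = 1` through which no other
hyperplane passes: let `α_j` be `1` at it, and the other simple roots `√2`. -/
theorem exists_generic_point [Finite ι] [P.IsRootSystem] [P.IsReduced] {b : P.Base} {j : ι}
    (hj : j ∈ b.support) :
    ∃ p : N, P.root' j p = 1 ∧ ∀ (i : ι) (k : ℤ), P.root' i p = k →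
      affineReflection P i k = affineReflection P j 1 := by
  classical
  obtain ⟨x, hx⟩ := exists_forall_root'_eq b fun i => if i = j then 1 else 0
  obtain ⟨y, hy⟩ := exists_forall_root'_eq b fun i => if i = j then 0 else 1
  have hxZ : x ∈ coweightLattice P := mem_coweightLattice_of_forall_mem_support b fun i hi =>
    ⟨if i = j then 1 else 0, by rw [hx i hi]; split_ifs <;> simp⟩
  have hyZ : y ∈ coweightLattice P := mem_coweightLattice_of_forall_mem_support b fun i hi =>
    ⟨if i = j then 0 else 1, by rw [hy i hi]; split_ifs <;> simp⟩
  have hxj : P.root' j x = 1 := by simp [hx j hj]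
  have hyj : P.root' j y = 0 := by simp [hy j hj]
  have hpj : P.root' j (x + √2 • y) = 1 := by simp [hxj, hyj]
  have hpos : ∀ (i : ι) (k : ℤ), b.IsPos i → P.root' i (x + √2 • y) = k → i = j ∧ k = 1 := by
    intro i k hi hk
    obtain ⟨m, hm⟩ := hxZ i
    obtain ⟨n, hn⟩ := hyZ i
    have hn0 : n = 0 := by
      by_contra hne
      have hirr : Irrational (√2 * n) := irrational_sqrt_two.mul_intCast hne
      refine hirr.ne_int (k - m) ?_
      rw [map_add, map_smul, hm, hn, smul_eq_mul] at hk
      push_cast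
      linarith
    have : i = j := by
      refine eq_of_isPos_of_root'_eq_zero hi hj (x := y) (fun k hk hkj => ?_) hyj
        (by rw [hn, hn0, Int.cast_zero])
      rw [hy k hk, if_neg hkj]
      exact one_pos
    subst this
    rw [hpj] at hk
    exact ⟨rfl, by exact_mod_cast hk.symm⟩
  refine ⟨x + √2 • y, hpj, fun i k hk => ?_⟩
  rcases isPos_or_isPos_reflectionPerm b i with hi | hi
  · obtain ⟨rfl, rfl⟩ := hpos i k hi hk
    rfl
  · obtain ⟨rfl, hk1⟩ := hpos _ (-k) hi (by rw [root'_reflectionPerm_self, hk]; push_cast; rfl)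
    rw [← hk1, affineReflection_reflectionPerm_self]

theorem corootLattice_eq_closure_support (b : P.Base) :
    corootLattice P = AddSubgroup.closure (P.coroot '' b.support) := by
  have := b.span_int_coroot_support
  apply_fun Submodule.toAddSubgroup at this
  rw [Submodule.span_int_eq_addSubgroupClosure, Submodule.span_int_eq_addSubgroupClosure] at this
  exact this.symm

/-- The affine Weyl group acts transitively on the alcoves. -/
theorem IsHighestRoot.exists_smul_add_mem_alcove [Finite ι] [P.IsRootSystem] [P.IsCrystallographic]
    {b : P.Base} {θ : ι} (hθ : IsHighestRoot b θ) {x : N}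
    (hx : ∀ (i : ι) (k : ℤ), P.root' i x ≠ k) :
    ∃ w : weylGroup P, ∃ q ∈ corootLattice P, w • x + q ∈ alcove b θ := by
  obtain ⟨g, hg, hgx⟩ := hθ.exists_mem_closedAlcove x
  have hgW := wallGroup_le_affineWeylGroup b θ hg
  have hA : g x ∈ alcove b θ := by
    refine mem_alcove_iff.mpr fun i k hik =>
      lt_of_le_of_ne (mem_closedAlcove_iff.mp hgx i k hik) fun h => ?_
    obtain ⟨u, v, huv, -⟩ := exists_affineRoot_comp hgW i k
    refine hx u v ?_
    have := huv x
    rw [← h, sub_self, eq_comm, sub_eq_zero] at this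
    exact this
  obtain ⟨w, q, hq, hgw⟩ := hgW
  exact ⟨w, q, hq, hgw x ▸ hA⟩

variable [Finite ι] [P.IsCrystallographic] [P.IsReduced]

theorem affineReflection_zero_mem_wallGroup (b : P.Base) (θ i : ι) :
    affineReflection P i 0 ∈ wallGroup b θ := by
  induction i using RootPairing.Base.induction_reflect (b := b) with
  | h₀ i hi => rwa [← neg_zero, affineReflection_reflectionPerm_self]
  | h₁ i hi => exact affineReflection_mem_wallGroup (Or.inl ⟨hi, rfl⟩)
  | h₂ i j hi hj =>
    have := affineReflection_mem_wallGroup (θ := θ) (Or.inl ⟨hj, rfl⟩)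
    rw [affineReflection_reflectionPerm]
    exact mul_mem (mul_mem this hi) this

theorem weylGroup_mem_wallGroup (b : P.Base) (θ : ι) (w : weylGroup P) :
    (w : N ≃ₗ[ℝ] N).toEquiv ∈ wallGroup b θ := by
  obtain ⟨w, hw⟩ := w
  change w.toEquiv ∈ _
  have h : ∀ i, (P.coreflection i).toEquiv ∈ wallGroup b θ := fun i => by
    have : (P.coreflection i).toEquiv = affineReflection P i 0 :=
      Equiv.ext fun x => (affineReflection_zero_apply i x).symm
    rw [this]
    exact affineReflection_zero_mem_wallGroup b θ i
  induction hw using Subgroup.closure_induction with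
  | one => exact one_mem _
  | mem w hw => obtain ⟨i, rfl⟩ := hw; exact h i
  | inv w _ hw => exact inv_mem hw
  | mul v w _ _ hv hw => exact mul_mem hv hw

variable [P.IsRootSystem] [P.IsIrreducible] {b : P.Base} {θ : ι} (hθ : IsHighestRoot b θ)

include hθ

/-- The reflection in `α_j = 1` is generated by wall reflections: an element of the wall group
moves a generic point of this hyperplane into the closed alcove, and so carries the hyperplane
to a wall. -/
theorem IsHighestRoot.affineReflection_one_mem_wallGroup {j : ι} (hj : j ∈ b.support) :
    affineReflection P j 1 ∈ wallGroup b θ := by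
  obtain ⟨p, hpj, huniq⟩ := exists_generic_point hj
  obtain ⟨g, hg, hgp⟩ := hθ.exists_mem_closedAlcove p
  have hgW := wallGroup_le_affineWeylGroup b θ hg
  obtain ⟨i, k, hik, hgpi⟩ : ∃ i k, IsWall b θ i k ∧ P.root' i (g p) = k := by
    by_contra! hne
    have hA : g p ∈ alcove b θ := mem_alcove_iff.mpr fun i k hik =>
      lt_of_le_of_ne (mem_closedAlcove_iff.mp hgp i k hik) (hne i k hik).symm
    obtain ⟨m, n, hmn, -⟩ := exists_affineRoot_comp (inv_mem hgW) j 1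
    have := hmn (g p)
    rw [show g⁻¹ (g p) = p from g.symm_apply_apply p, hpj, Int.cast_one, sub_self, eq_comm,
      sub_eq_zero] at this
    exact hθ.root'_ne_intCast hA m n this
  obtain ⟨u, v, huv, hrefl⟩ := exists_affineRoot_comp hgW i k
  have hup : P.root' u p = v := by
    have := huv p
    rw [hgpi, sub_self, eq_comm, sub_eq_zero] at this
    exact this
  rw [← huniq u v hup]
  have : affineReflection P u v = g⁻¹ * affineReflection P i k * g := by
    rw [mul_assoc, hrefl, inv_mul_cancel_left]
  rw [this]
  exact mul_mem (mul_mem (inv_mem hg) (affineReflection_mem_wallGroup hik)) hg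

theorem IsHighestRoot.addRight_mem_wallGroup {q : N} (hq : q ∈ corootLattice P) :
    Equiv.addRight q ∈ wallGroup b θ := by
  rw [corootLattice_eq_closure_support b] at hq
  induction hq using AddSubgroup.closure_induction with
  | mem q hq =>
    obtain ⟨j, hj, rfl⟩ := hq
    have : Equiv.addRight (P.coroot j) = affineReflection P j 1 * affineReflection P j 0 := by
      ext x
      simp only [Equiv.coe_addRight, Equiv.Perm.mul_apply, affineReflection_apply, map_sub,
        map_smul, P.root'_coroot_eq_pairing, P.pairing_same, smul_eq_mul]
      push_cast
      module
    rw [this]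
    exact mul_mem (hθ.affineReflection_one_mem_wallGroup hj)
      (affineReflection_zero_mem_wallGroup b θ j)
  | zero => rw [Equiv.addRight_zero]; exact one_mem _
  | add x y _ _ hx hy =>
    have : Equiv.addRight (x + y) = Equiv.addRight y * Equiv.addRight x :=
      Equiv.ext fun z => (add_assoc z x y).symm
    rw [this]; exact mul_mem hy hx
  | neg x _ hx =>
    have : Equiv.addRight (-x) = (Equiv.addRight x)⁻¹ := Equiv.ext fun z => rfl
    rw [this]; exact inv_mem hx

/-- The affine Weyl group acts freely on the alcoves. -/
theorem IsHighestRoot.eq_one_of_smul_add_mem_alcove {a : N} (ha : a ∈ alcove b θ) {w : weylGroup P}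
    {q : N} (hq : q ∈ corootLattice P) (h : w • a + q ∈ alcove b θ) : w = 1 := by
  let g : Equiv.Perm N := Equiv.addRight q * (w : N ≃ₗ[ℝ] N).toEquiv
  have hg : g = 1 := hθ.eq_one_of_mem_wallGroup ha
    (mul_mem (hθ.addRight_mem_wallGroup hq) (weylGroup_mem_wallGroup b θ w)) h
  have hg' : ∀ x, w • x + q = x := fun x => congrArg (fun e : Equiv.Perm N => e x) hg
  have hq0 : q = 0 := by simpa using hg' 0
  apply Subtype.ext
  ext x
  have := hg' x
  rwa [hq0, add_zero] at this

end Generation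

/-! ### Permutation characters and induction -/

section Induction

/-- A permutation character counts fixed points. -/
theorem permChar_apply {G X : Type*} [Group G] [MulAction G X] [Finite X] (g : G) :
    permChar G X g = Nat.card (MulAction.fixedBy X g) := by
  classical
  have := Fintype.ofFinite X
  rw [permChar, Representation.character, LinearMap.trace_eq_matrix_trace ℂ
    (MonoidAlgebra.basis X ℂ), Matrix.trace]
  have : ∀ x : X, (LinearMap.toMatrix (MonoidAlgebra.basis X ℂ) (MonoidAlgebra.basis X ℂ)
      (Representation.ofMulAction ℂ G X g)).diag x = if g • x = x then 1 else 0 := by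
    intro x
    rw [Matrix.diag_apply, LinearMap.toMatrix_apply, MonoidAlgebra.basis_apply,
      Representation.ofMulAction_single, ← MonoidAlgebra.basis_apply, Module.Basis.repr_self,
      Finsupp.single_apply]
  rw [Finset.sum_congr rfl fun x _ => this x, Finset.sum_boole, Nat.card_eq_fintype_card,
    Fintype.card_subtype]
  rfl

variable {G X Y T : Type*} [Group G] [MulAction G X] [MulAction G T] {H : Subgroup G}
  [MulAction H Y] {φ : X → T} {ψ : Y → T}

/-- Let `T` be a `G`-set with an `H`-stable subset `Y` such that each `g` for which `g Y` meets `Y`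
lies in `H`, and let `X` be the union of the translates of `Y`.  Then each point of `X` is of the
form `s y` in `#H` ways.  The sets `X` and `Y` are given by injections `φ` and `ψ` into `T`. -/
theorem card_fixedBy_mul (hφ : Function.Injective φ) (hψ : Function.Injective ψ)
    (hφG : ∀ (g : G) x, φ (g • x) = g • φ x) (hψH : ∀ (h : H) y, ψ (h • y) = (h : G) • ψ y)
    (hX : ∀ x, ∃ (g : G) (y : Y), φ x = g • ψ y) (hY : ∀ (g : G) y, ∃ x, φ x = g • ψ y)
    (hH : ∀ (g : G) y y', g • ψ y = ψ y' → g ∈ H) (g : G) :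
    Nat.card H * Nat.card (MulAction.fixedBy X g) =
      Nat.card {p : G × Y // g • p.1 • ψ p.2 = p.1 • ψ p.2} := by
  choose s y hsy using hX
  rw [← Nat.card_prod]
  refine Nat.card_eq_of_bijective
    (fun p : H × MulAction.fixedBy X g =>
      (⟨(s p.2 * (p.1 : G)⁻¹, p.1 • y p.2), ?_⟩ :
        {p : G × Y // g • p.1 • ψ p.2 = p.1 • ψ p.2})) ⟨?_, ?_⟩
  · rw [hψH, mul_smul, inv_smul_smul, ← hsy, ← hφG, p.2.2]
  · rintro ⟨h, x⟩ ⟨h', x'⟩ heq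
    have heq1 := congrArg (fun p => p.1.1) heq
    have heq2 := congrArg (fun p => p.1.2) heq
    dsimp only at heq1 heq2
    have hx : x = x' := by
      apply Subtype.ext
      apply hφ
      have e1 : φ x = (s x * (h : G)⁻¹) • ψ (h • y x) := by
        rw [hψH, mul_smul, inv_smul_smul, ← hsy]
      have e2 : φ x' = (s x' * (h' : G)⁻¹) • ψ (h' • y x') := by
        rw [hψH, mul_smul, inv_smul_smul, ← hsy]
      rw [e1, e2, heq1, heq2]
    subst hx
    rw [mul_right_inj, inv_inj] at heq1
    rw [Subtype.ext heq1]
  · rintro ⟨⟨t, z⟩, htz⟩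
    dsimp only at htz
    obtain ⟨x, hx⟩ := hY t z
    have hxg : x ∈ MulAction.fixedBy X g := by
      apply hφ
      rw [hφG, hx, htz]
    have hmem : t⁻¹ * s x ∈ H := by
      refine hH _ (y x) z ?_
      rw [mul_smul, ← hsy, hx, inv_smul_smul]
    refine ⟨(⟨_, hmem⟩, ⟨x, hxg⟩), Subtype.ext (Prod.ext ?_ (hψ ?_))⟩
    · simp
    · dsimp only
      rw [hψH, mul_smul, ← hsy, hx, inv_smul_smul]

/-- In the situation of `card_fixedBy_mul`, the permutation character of `G` on `X` is induced by
that of `H` on `Y`. -/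
theorem permChar_eq_inducedChar [Finite G] [Finite X] [Finite Y] (hφ : Function.Injective φ)
    (hψ : Function.Injective ψ)
    (hφG : ∀ (g : G) x, φ (g • x) = g • φ x) (hψH : ∀ (h : H) y, ψ (h • y) = (h : G) • ψ y)
    (hX : ∀ x, ∃ (g : G) (y : Y), φ x = g • ψ y) (hY : ∀ (g : G) y, ∃ x, φ x = g • ψ y)
    (hH : ∀ (g : G) y y', g • ψ y = ψ y' → g ∈ H) :
    permChar G X = inducedChar H (permChar H Y) := by
  ext g
  have hcard := card_fixedBy_mul hφ hψ hφG hψH hX hY hH g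
  let e : {p : G × Y // g • p.1 • ψ p.2 = p.1 • ψ p.2} ≃
      Σ s : {s : G // s⁻¹ * g * s ∈ H}, MulAction.fixedBy Y (⟨_, s.2⟩ : H) :=
    { toFun := fun p =>
        have h : (p.1.1⁻¹ * g * p.1.1) • ψ p.1.2 = ψ p.1.2 := by
          rw [mul_smul, mul_smul, p.2, inv_smul_smul]
        ⟨⟨p.1.1, hH _ _ _ h⟩, ⟨p.1.2, hψ ((hψH _ _).trans h)⟩⟩
      invFun := fun p => ⟨(p.1.1, p.2.1), by
        have h := congrArg ψ p.2.2
        rw [hψH, mul_smul, mul_smul, inv_smul_eq_iff] at h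
        exact h⟩
      left_inv := fun _ => rfl
      right_inv := fun _ => rfl }
  have := Fintype.ofFinite {s : G // s⁻¹ * g * s ∈ H}
  rw [Nat.card_congr e, Nat.card_sigma] at hcard
  have hH0 : (Nat.card H : ℂ) ≠ 0 := Nat.cast_ne_zero.mpr Nat.card_pos.ne'
  rw [inducedChar, permChar_apply, finsum_eq_sum_of_fintype, eq_inv_mul_iff_mul_eq₀ hH0]
  simp only [permChar_apply]
  exact_mod_cast hcard

theorem card_mul_card_eq (hφ : Function.Injective φ)
    (hψ : Function.Injective ψ)
    (hφG : ∀ (g : G) x, φ (g • x) = g • φ x) (hψH : ∀ (h : H) y, ψ (h • y) = (h : G) • ψ y)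
    (hX : ∀ x, ∃ (g : G) (y : Y), φ x = g • ψ y) (hY : ∀ (g : G) y, ∃ x, φ x = g • ψ y)
    (hH : ∀ (g : G) y y', g • ψ y = ψ y' → g ∈ H) :
    Nat.card H * Nat.card X = Nat.card G * Nat.card Y := by
  have hcard := card_fixedBy_mul hφ hψ hφG hψH hX hY hH 1
  rwa [MulAction.fixedBy_one_eq_univ, Nat.card_univ, Nat.card_congr
    (Equiv.subtypeUnivEquiv fun p : G × Y => one_smul G (p.1 • ψ p.2)), Nat.card_prod] at hcard

end Induction

/-! ### The torus -/

section Torus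

variable {ι M N : Type*} [AddCommGroup M] [Module ℝ M] [AddCommGroup N] [Module ℝ N]
  {P : RootPairing ι ℝ M N}

theorem smul_torus_mk (w : weylGroup P) (x : N) :
    w • (QuotientAddGroup.mk x : Torus P) = QuotientAddGroup.mk (w • x) := rfl

theorem torus_mk_eq_iff {x y : N} : (QuotientAddGroup.mk x : Torus P) = QuotientAddGroup.mk y ↔
    ∃ z ∈ coweightLattice P, x + z = y := by
  rw [QuotientAddGroup.eq]
  exact ⟨fun h => ⟨_, h, by abel⟩, fun ⟨z, hz, h⟩ => by rwa [← h, neg_add_cancel_left]⟩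

/-- The Weyl group acts trivially on `Z / Q^∨`. -/
theorem smul_sub_mem_corootLattice (w : weylGroup P) {z : N} (hz : z ∈ coweightLattice P) :
    w • z - z ∈ corootLattice P := by
  have hrefl : ∀ i, ∀ z ∈ coweightLattice P, P.coreflection i z - z ∈ corootLattice P := by
    intro i z hz
    obtain ⟨n, hn⟩ := hz i
    rw [P.coreflection_apply, hn, sub_sub_cancel_left, Int.cast_smul_eq_zsmul]
    exact neg_mem (zsmul_mem (AddSubgroup.subset_closure (Set.mem_range_self i)) n)
  obtain ⟨w, hw⟩ := w
  change w z - z ∈ _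
  induction hw using Subgroup.closure_induction'' generalizing z with
  | one => simp
  | mem w hw => obtain ⟨i, rfl⟩ := hw; exact hrefl i z hz
  | inv_mem w hw => obtain ⟨i, rfl⟩ := hw; exact hrefl i z hz
  | mul v w hv' hw' hv hw =>
    have := add_mem (hv (smul_mem_coweightLattice ⟨w, hw'⟩ z hz)) (hw hz)
    rwa [show ((⟨w, hw'⟩ : weylGroup P) • z) = w z from rfl, sub_add_sub_cancel] at this

theorem affineWeyl_smul_torus (w : weylGroup P) {q : N} (hq : q ∈ coweightLattice P) (x : N) :
    w • (QuotientAddGroup.mk x : Torus P) = QuotientAddGroup.mk (w • x + q) := by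
  rw [smul_torus_mk, torus_mk_eq_iff]
  exact ⟨q, hq, rfl⟩

/-- The projection to the torus is injective on the fundamental alcove. -/
theorem IsHighestRoot.eq_zero_of_add_mem_alcove [Finite ι] [P.IsRootSystem] [P.IsCrystallographic]
    [P.IsReduced] [P.IsIrreducible] {b : P.Base} {θ : ι} (hθ : IsHighestRoot b θ) {x z : N}
    (hz : z ∈ coweightLattice P) (hx : x ∈ alcove b θ) (hxz : x + z ∈ alcove b θ) : z = 0 := by
  have hpos : ∀ i, b.IsPos i → P.root' i z = 0 := by
    intro i hi
    obtain ⟨n, hn⟩ := hz i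
    obtain ⟨h1, h2⟩ := hθ.root'_mem_Ioo hx hi
    obtain ⟨h3, h4⟩ := hθ.root'_mem_Ioo hxz hi
    rw [map_add, hn] at h3 h4
    have h5 : (-1 : ℝ) < n := by linarith
    have h6 : (n : ℝ) < 1 := by linarith
    norm_cast at h5 h6
    obtain rfl : n = 0 := by omega
    simpa using hn
  refine eq_of_forall_root'_eq (P := P) fun i => ?_
  rw [map_zero]
  rcases isPos_or_isPos_reflectionPerm b i with hi | hi
  · exact hpos i hi
  · have := hpos _ hi
    rwa [root'_reflectionPerm_self, neg_eq_zero] at this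

section Highest

variable [Finite ι] [P.IsCrystallographic] [P.IsReduced] [P.IsIrreducible]
  {b : P.Base} {θ : ι} (hθ : IsHighestRoot b θ)

include hθ

/-- An extended affine Weyl group element that maps a point of the fundamental alcove into the
fundamental alcove maps the whole alcove into itself. -/
theorem IsHighestRoot.smul_add_mem_alcove {w : weylGroup P} {x y z : N}
    (hz : z ∈ coweightLattice P) (hx : x ∈ alcove b θ) (hxz : w • x + z ∈ alcove b θ)
    (hy : y ∈ alcove b θ) : w • y + z ∈ alcove b θ := by
  refine mem_alcove_iff.mpr fun i k hik => ?_
  obtain ⟨j, hj⟩ := exists_root_comp w i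
  obtain ⟨n, hn⟩ := hz i
  have h1 := mem_alcove_iff.mp hxz i k hik
  rw [map_add, hj, hn] at h1 ⊢
  have h2 : ((k - n : ℤ) : ℝ) < P.root' j x := by push_cast; linarith
  have h3 := lt_of_le_of_ne (hθ.le_root'_of_lt hx (alcove_subset_closedAlcove b θ hy) h2)
    (hθ.root'_ne_intCast hy j _).symm
  push_cast at h3
  linarith

theorem IsHighestRoot.mem_alcoveStab {w : weylGroup P} {x z : N}
    (hz : z ∈ coweightLattice P) (hx : x ∈ alcove b θ) (hxz : w • x + z ∈ alcove b θ) :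
    w ∈ alcoveStab b θ := by
  have hsub : ∀ (w : weylGroup P) (x z : N), z ∈ coweightLattice P → x ∈ alcove b θ →
      w • x + z ∈ alcove b θ → w • alcoveT b θ ⊆ alcoveT b θ := by
    rintro w x z hz hx hxz _ ⟨_, ⟨y, hy, rfl⟩, rfl⟩
    refine ⟨_, hθ.smul_add_mem_alcove hz hx hxz hy, ?_⟩
    exact (affineWeyl_smul_torus w hz y).symm
  rw [alcoveStab, MulAction.mem_stabilizer_iff]
  refine (hsub w x z hz hx hxz).antisymm ?_
  rw [Set.subset_smul_set_iff]
  refine hsub w⁻¹ _ (-(w⁻¹ • z)) (neg_mem (smul_mem_coweightLattice _ z hz)) hxz ?_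
  rwa [smul_add, inv_smul_smul, add_neg_cancel_right]

theorem IsHighestRoot.mem_alcoveStab_of_smul_mem {w : weylGroup P} {s t : Torus P}
    (hs : s ∈ alcoveT b θ) (ht : t ∈ alcoveT b θ) (h : w • s = t) : w ∈ alcoveStab b θ := by
  obtain ⟨x, hx, rfl⟩ := hs
  obtain ⟨y, hy, rfl⟩ := ht
  obtain ⟨z, hz, rfl⟩ := torus_mk_eq_iff.mp h
  exact hθ.mem_alcoveStab hz hx hy

/-- The isotropy group of the alcove in the torus is `Z / Q^∨`: to `w` corresponds the class of the
`z` for which `x ↦ w x + z` maps the alcove to itself, and simple transitivity of the affine Weyl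
group on alcoves means that every class has exactly one such `w`. -/
theorem IsHighestRoot.card_alcoveStab [P.IsRootSystem] :
    Nat.card (alcoveStab b θ) = connectionIndex P := by
  obtain ⟨a, ha⟩ := hθ.alcove_nonempty
  have hex : ∀ w : alcoveStab b θ, ∃ z : coweightLattice P,
      (w : weylGroup P) • a + z ∈ alcove b θ := by
    rintro ⟨w, hw⟩
    have h : w • (QuotientAddGroup.mk a : Torus P) ∈ w • alcoveT b θ :=
      Set.smul_mem_smul_set ⟨a, ha, rfl⟩
    rw [MulAction.mem_stabilizer_iff.mp hw] at h
    obtain ⟨y, hy, hya⟩ := h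
    obtain ⟨z, hz, rfl⟩ := torus_mk_eq_iff.mp hya.symm
    exact ⟨⟨z, hz⟩, hy⟩
  choose z hz using hex
  change _ = Nat.card (coweightLattice P ⧸ (corootLattice P).addSubgroupOf (coweightLattice P))
  refine Nat.card_eq_of_bijective (fun w => QuotientAddGroup.mk (z w))
    ⟨fun v w hvw => ?_, fun t => ?_⟩
  · rw [QuotientAddGroup.eq, AddSubgroup.mem_addSubgroupOf] at hvw
    apply Subtype.ext
    rw [eq_comm, ← mul_inv_eq_one]
    -- `u` is the linear part of the affine Weyl group element that carries `v a + z v` to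
    -- `w a + z w`, both points of the alcove
    set u : weylGroup P := (w : weylGroup P) * (v : weylGroup P)⁻¹ with hu
    have hq : (z w : N) - u • (z v : N) ∈ corootLattice P := by
      have h1 := smul_sub_mem_corootLattice u (z v).2
      have h2 := sub_mem hvw h1
      have h3 : ((-z v + z w : coweightLattice P) : N) - (u • (z v : N) - z v) =
          z w - u • (z v : N) := by
        push_cast; abel
      rwa [h3] at h2
    refine hθ.eq_one_of_smul_add_mem_alcove (hz v) hq ?_
    have h4 : u • ((v : weylGroup P) • a + (z v : N)) + (z w - u • (z v : N)) =
        (w : weylGroup P) • a + z w := by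
      rw [smul_add, hu, mul_smul, inv_smul_smul]; abel
    rw [h4]
    exact hz w
  · obtain ⟨t, rfl⟩ := QuotientAddGroup.mk_surjective t
    obtain ⟨w, q, hq, hw⟩ := hθ.exists_smul_add_mem_alcove (x := a + t) fun i k h => by
      obtain ⟨n, hn⟩ := t.2 i
      rw [map_add, hn] at h
      refine hθ.root'_ne_intCast ha i (k - n) ?_
      push_cast
      linarith
    have hmem : w • (t : N) + q ∈ coweightLattice P :=
      add_mem (smul_mem_coweightLattice w _ t.2) (corootLattice_le_coweightLattice hq)
    rw [smul_add, add_assoc] at hw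
    refine ⟨⟨w, hθ.mem_alcoveStab hmem ha hw⟩, ?_⟩
    set v : alcoveStab b θ := ⟨w, hθ.mem_alcoveStab hmem ha hw⟩
    have hzv : (z v : N) = w • (t : N) + q := by
      have h1 : w • a + (z v : N) + (w • (t : N) + q - z v) ∈ alcove b θ := by
        rwa [add_assoc, add_sub_cancel]
      have := hθ.eq_zero_of_add_mem_alcove (sub_mem hmem (z v).2) (hz v) h1
      exact (sub_eq_zero.mp this).symm
    refine (QuotientAddGroup.eq.mpr ?_).symm
    rw [AddSubgroup.mem_addSubgroupOf]
    have h2 : ((-t + z v : coweightLattice P) : N) = (w • (t : N) - t) + q := by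
      push_cast
      rw [hzv]; abel
    rw [h2]
    exact add_mem (smul_sub_mem_corootLattice w t.2) hq

end Highest

section Torsion

/-- Division by `q`, as a homomorphism from `Z / qZ` to the torus.  For `q > 0` it identifies
`Z / qZ` with the `q`-torsion of the torus. -/
noncomputable def divTorus (P : RootPairing ι ℝ M N) (q : ℕ) (hq : 0 < q) :
    CoweightMod P q →+ Torus P :=
  QuotientAddGroup.lift _
    ((QuotientAddGroup.mk' (coweightLattice P)).comp
      ((DistribSMul.toAddMonoidHom N (q : ℝ)⁻¹).comp (coweightLattice P).subtype)) <| by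
    rintro _ ⟨y, rfl⟩
    refine (QuotientAddGroup.eq_zero_iff _).mpr ?_
    have hq' : (q : ℝ) ≠ 0 := Nat.cast_ne_zero.mpr hq.ne'
    change (q : ℝ)⁻¹ • ((q • y : coweightLattice P) : N) ∈ coweightLattice P
    rw [AddSubgroup.coe_nsmul, ← Nat.cast_smul_eq_nsmul ℝ, inv_smul_smul₀ hq']
    exact y.2

theorem divTorus_mk {q : ℕ} (hq : 0 < q) (x : coweightLattice P) :
    divTorus P q hq (QuotientAddGroup.mk x) = QuotientAddGroup.mk ((q : ℝ)⁻¹ • (x : N)) := rfl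

theorem mk_eq_mk_of_inv_smul_sub_mem {q : ℕ} (hq : 0 < q) {x y : coweightLattice P}
    (h : (q : ℝ)⁻¹ • ((y : N) - x) ∈ coweightLattice P) :
    (QuotientAddGroup.mk x : CoweightMod P q) = QuotientAddGroup.mk y := by
  have hq' : (q : ℝ) ≠ 0 := Nat.cast_ne_zero.mpr hq.ne'
  refine QuotientAddGroup.eq.mpr ⟨⟨_, h⟩, Subtype.ext ?_⟩
  change q • ((q : ℝ)⁻¹ • ((y : N) - x)) = -(x : N) + y
  rw [← Nat.cast_smul_eq_nsmul ℝ, smul_inv_smul₀ hq']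
  abel

theorem divTorus_injective {q : ℕ} (hq : 0 < q) : Function.Injective (divTorus P q hq) := by
  intro s t hst
  obtain ⟨x, rfl⟩ := QuotientAddGroup.mk_surjective s
  obtain ⟨y, rfl⟩ := QuotientAddGroup.mk_surjective t
  rw [divTorus_mk, divTorus_mk] at hst
  refine mk_eq_mk_of_inv_smul_sub_mem hq ?_
  rw [smul_sub]
  have := QuotientAddGroup.eq.mp hst
  rwa [neg_add_eq_sub] at this

theorem divTorus_smul {q : ℕ} (hq : 0 < q) (w : weylGroup P) (t : CoweightMod P q) :
    divTorus P q hq (w • t) = w • divTorus P q hq t := by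
  obtain ⟨x, rfl⟩ := QuotientAddGroup.mk_surjective t
  rw [divTorus_mk, smul_torus_mk, smul_comm]
  rfl

/-- A class of `Z / qZ` is determined by the values of the roots modulo `q`. -/
theorem finite_coweightMod [Finite ι] {q : ℕ} (hq : 0 < q) : Finite (CoweightMod P q) := by
  have : NeZero q := ⟨hq.ne'⟩
  have h := fun x : coweightLattice P => x.2
  choose n hn using h
  refine Finite.of_injective
    (fun (t : CoweightMod P q) i => (n (Quotient.out t) i : ZMod q)) fun s t hst => ?_
  rw [← QuotientAddGroup.out_eq' s, ← QuotientAddGroup.out_eq' t]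
  refine mk_eq_mk_of_inv_smul_sub_mem hq fun i => ?_
  have h1 := (ZMod.intCast_eq_intCast_iff_dvd_sub _ _ _).mp (congrFun hst i)
  obtain ⟨m, hm⟩ := h1
  have hq' : (q : ℝ) ≠ 0 := Nat.cast_ne_zero.mpr hq.ne'
  refine ⟨m, ?_⟩
  rw [map_smul, map_sub, hn, hn, smul_eq_mul, inv_mul_eq_iff_eq_mul₀ hq']
  exact_mod_cast hm

/-- Each point of the complement of the arrangement is, in the torus, a translate of a torsion
point of the alcove. -/
theorem IsHighestRoot.exists_divTorus_eq_smul [Finite ι] [P.IsRootSystem]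
    [P.IsCrystallographic] {b : P.Base} {θ : ι} (hθ : IsHighestRoot b θ) {q : ℕ} (hq : 0 < q)
    (x : arrComplement P q) :
    ∃ (w : weylGroup P) (t : alcoveTorsion b θ q), divTorus P q hq x = w • (t : Torus P) := by
  obtain ⟨_, ⟨x, hx, rfl⟩⟩ := x
  have hq' : (q : ℝ) ≠ 0 := Nat.cast_ne_zero.mpr hq.ne'
  obtain ⟨w, r, hr, hw⟩ := hθ.exists_smul_add_mem_alcove (x := (q : ℝ)⁻¹ • (x : N)) fun i k h => by
    refine hx i ⟨k, ?_⟩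
    rwa [map_smul, smul_eq_mul, inv_mul_eq_iff_eq_mul₀ hq'] at h
  have hrZ := corootLattice_le_coweightLattice hr
  refine ⟨w⁻¹, ⟨QuotientAddGroup.mk (w • (q : ℝ)⁻¹ • (x : N) + r), ⟨_, hw, rfl⟩, ?_⟩, ?_⟩
  · refine (QuotientAddGroup.eq_zero_iff _).mpr (?_ : q • _ ∈ _)
    rw [nsmul_add, ← Nat.cast_smul_eq_nsmul ℝ, smul_comm, smul_inv_smul₀ hq']
    exact add_mem (smul_mem_coweightLattice w _ x.2) (nsmul_mem hrZ q)
  · rw [eq_inv_smul_iff]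
    exact affineWeyl_smul_torus w hrZ _

variable [Finite ι] [P.IsCrystallographic] [P.IsReduced] [P.IsIrreducible]
  {b : P.Base} {θ : ι} (hθ : IsHighestRoot b θ)

include hθ

theorem IsHighestRoot.exists_divTorus_eq {q : ℕ} (hq : 0 < q)
    (w : weylGroup P) (t : alcoveTorsion b θ q) :
    ∃ x : arrComplement P q, divTorus P q hq x = w • (t : Torus P) := by
  obtain ⟨_, ⟨a, ha, rfl⟩, hqt⟩ := t
  have hq' : (q : ℝ) ≠ 0 := Nat.cast_ne_zero.mpr hq.ne'
  have hqa : q • a ∈ coweightLattice P := (QuotientAddGroup.eq_zero_iff (q • a)).mp hqt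
  refine ⟨⟨_, ⟨⟨w • (q • a), smul_mem_coweightLattice w _ hqa⟩, fun i => ?_, rfl⟩⟩, ?_⟩
  · rintro ⟨k, hk⟩
    obtain ⟨j, hj⟩ := exists_root_comp w i
    change P.root' i (w • (q • a)) = _ at hk
    rw [hj, map_nsmul, nsmul_eq_mul, mul_right_inj' hq'] at hk
    exact hθ.root'_ne_intCast ha j k hk
  · rw [divTorus_mk, smul_torus_mk, smul_comm, ← Nat.cast_smul_eq_nsmul ℝ q a,
      inv_smul_smul₀ hq']

/-- Multiplication by `q` is a bijection from the `q`-torsion points of the alcove in the torus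
to the lattice points of `q A`. -/
theorem IsHighestRoot.card_alcoveTorsion [P.IsRootSystem] {q : ℕ} (hq : 0 < q) :
    Nat.card (alcoveTorsion b θ q) = alcoveEhrhart b θ q := by
  have hq' : (q : ℝ) ≠ 0 := Nat.cast_ne_zero.mpr hq.ne'
  have hA : ∀ x : ↥((q : ℝ) • alcove b θ ∩ (coweightLattice P : Set N)),
      (q : ℝ)⁻¹ • (x : N) ∈ alcove b θ := fun x =>
    (Set.mem_smul_set_iff_inv_smul_mem₀ hq' _ _).mp x.2.1
  symm
  refine Nat.card_eq_of_bijective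
    (fun x => (⟨QuotientAddGroup.mk ((q : ℝ)⁻¹ • (x : N)), ⟨_, hA x, rfl⟩, ?_⟩ :
      alcoveTorsion b θ q)) ⟨fun x y hxy => ?_, ?_⟩
  · refine (QuotientAddGroup.eq_zero_iff _).mpr (?_ : q • _ ∈ _)
    rw [← Nat.cast_smul_eq_nsmul ℝ, smul_inv_smul₀ hq']
    exact x.2.2
  · obtain ⟨z, hz, hzxy⟩ := torus_mk_eq_iff.mp (congrArg Subtype.val hxy)
    have := hA y
    rw [← hzxy] at this
    rw [hθ.eq_zero_of_add_mem_alcove hz (hA x) this, add_zero] at hzxy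
    exact Subtype.ext (smul_right_injective N (inv_ne_zero hq') hzxy)
  · rintro ⟨_, ⟨a, ha, rfl⟩, hqt⟩
    have hqa : q • a ∈ coweightLattice P := (QuotientAddGroup.eq_zero_iff (q • a)).mp hqt
    rw [← Nat.cast_smul_eq_nsmul ℝ] at hqa
    refine ⟨⟨(q : ℝ) • a, Set.smul_mem_smul_set ha, hqa⟩, Subtype.ext ?_⟩
    dsimp only
    rw [inv_smul_smul₀ hq']

end Torsion

end Torus

end EquivCharQuasi

theorem theorem1p3 {ι M N : Type*} [Finite ι] [AddCommGroup M] [Module ℝ M]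
    [AddCommGroup N] [Module ℝ N] (P : RootPairing ι ℝ M N) [P.IsRootSystem]
    [P.IsCrystallographic] [P.IsReduced] [P.IsIrreducible]
    (b : P.Base) (θ : ι) (hθ : EquivCharQuasi.IsHighestRoot b θ) :
    (∀ q : ℕ, 0 < q →
      EquivCharQuasi.arrChar P q =
        EquivCharQuasi.inducedChar (EquivCharQuasi.alcoveStab b θ)
          (EquivCharQuasi.alcoveChar b θ q)) ∧
    Nat.card (EquivCharQuasi.alcoveStab b θ) = EquivCharQuasi.connectionIndex P ∧
    (∀ q : ℕ, 0 < q →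
      EquivCharQuasi.connectionIndex P * Nat.card (EquivCharQuasi.arrComplement P q) =
        Nat.card (EquivCharQuasi.weylGroup P) * EquivCharQuasi.alcoveEhrhart b θ q) := by
  have hφ : ∀ (q : ℕ) (hq : 0 < q), Function.Injective
      fun x : EquivCharQuasi.arrComplement P q => EquivCharQuasi.divTorus P q hq x :=
    fun q hq => (EquivCharQuasi.divTorus_injective hq).comp Subtype.val_injective
  have hψ : ∀ q : ℕ, Function.Injective
      (Subtype.val : EquivCharQuasi.alcoveTorsion b θ q → EquivCharQuasi.Torus P) :=
    fun q => Subtype.val_injective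
  refine ⟨fun q hq => ?_, hθ.card_alcoveStab, fun q hq => ?_⟩
  · have := EquivCharQuasi.finite_coweightMod (P := P) hq
    have hX : Finite (EquivCharQuasi.arrComplement P q) := Subtype.finite
    have hY : Finite (EquivCharQuasi.alcoveTorsion b θ q) := by
      choose f hf using hθ.exists_divTorus_eq hq 1
      refine Finite.of_injective f fun s t hst => Subtype.ext ?_
      rw [← one_smul (EquivCharQuasi.weylGroup P) (s : EquivCharQuasi.Torus P), ← hf, hst, hf,
        one_smul]
    exact EquivCharQuasi.permChar_eq_inducedChar (hφ q hq) (hψ q)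
      (fun w x => EquivCharQuasi.divTorus_smul hq w x) (fun _ _ => rfl)
      (hθ.exists_divTorus_eq_smul hq) (hθ.exists_divTorus_eq hq)
      fun w s t h => hθ.mem_alcoveStab_of_smul_mem s.2.1 t.2.1 h
  · rw [← hθ.card_alcoveStab, ← hθ.card_alcoveTorsion hq]
    exact EquivCharQuasi.card_mul_card_eq (hφ q hq) (hψ q)
      (fun w x => EquivCharQuasi.divTorus_smul hq w x) (fun _ _ => rfl)
      (hθ.exists_divTorus_eq_smul hq) (hθ.exists_divTorus_eq hq)
      fun w s t h => hθ.mem_alcoveStab_of_smul_mem s.2.1 t.2.1 h
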